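/- All rings and algebras are commutative. An algebra $A$ over a ring $R$ has rank $n$ if the $r\in R$ such that $A_r$ is a free $R_r$-module of rank $n$ generate the unit ideal of $R$. Tensor products are over $R$ unless indicated; $S_n$ acts on $A^{\otimes n}$ by permuting the tensor factors, and $(A^{\otimes n})^G$ denotes the subalgebra of invariants of a subgroup $G\le S_n$. For an $R$-algebra $A$ of rank $n$, the norm $N_{A/R}(a)\in R$ of $a\in A$ is the element with $(aa_1)\wedge\dots\wedge(aa_n)=N_{A/R}(a)\,(a_1\wedge\dots\wedge a_n)$ for all $a_1,\dots,a_n\in A$. The Ferrand homomorphism $\Phi_{A/R}\colon (A^{\otimes n})^{S_n}\to R$ is the $R$-algebra homomorphism corresponding to the norm as a polynomial law: it sends $a\otimes\dots\otimes a$ to $N_{A/R}(a)$, and so does its base change to every $R$-algebra $R'$, i.e. it is compatible, via $(A^{\otimes n})^{S_n}\to (A'^{\otimes_{R'} n})^{S_n}$, with an $R'$-algebra homomorphism $(A'^{\otimes_{R'} n})^{S_n}\to R'$ sending $a'\otimes\dots\otimes a'$ to $N_{A'/R'}(a')$ for all $a'\in A'=R'\otimes_R A$. A closure datum for $A$ over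 $R$ is a pair $(G,\phi)$ of a subgroup $G\le S_n$ and an $R$-algebra homomorphism $\phi\colon (A^{\otimes n})^G\to R$ that restricts to $\Phi_{A/R}$ on $(A^{\otimes n})^{S_n}$. Its closure algebra is $C(A,\phi):=A^{\otimes n}\otimes_{(A^{\otimes n})^G}R$, where $R$ is an $(A^{\otimes n})^G$-algebra via $\phi$. **Theorem.** Let $R$ be a ring and, for $i=1,\dots,k$, let $A_i$ be an $R$-algebra of rank $n_i$ with a closure datum $(G_i,\phi_i)$. Put $n=\sum_i n_i$, $A=\prod_i A_i$, and let $G=\prod_i G_i$, a subgroup of $S_n$ through the action of $G_i$ on the $n_i$-element set $\{n_1+\dots+n_{i-1}+1,\dots,n_1+\dots+n_i\}$. Then: 1. $A$ is an $R$-algebra of rank $n$. 2. The isomorphism $A^{\otimes n}\cong\bigotimes_i A^{\otimes n_i}$ that groups the factors restricts to an isomorphism $(A^{\otimes n})^{G}\cong\bigotimes_i (A^{\otimes n_i})^{G_i}$ (that is, the natural map from right to left is bijective), and the map $\bigotimes_i (A^{\otimes n_i})^{G_i}\to\bigotimes_i (A_i^{\otimes n_i})^{G_i}$ induced by the projections $A\to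 A_i$ is surjective. 3. Let $\phi\colon (A^{\otimes n})^G\to R$ be the composite $$(A^{\otimes n})^{G}\;\cong\;\bigotimes_i (A^{\otimes n_i})^{G_i}\;\to\;\bigotimes_i (A_i^{\otimes n_i})^{G_i}\;\xrightarrow{\ \bigotimes_i\phi_i\ }\;R .$$ Then $(G,\phi)$ is a closure datum for $A$ over $R$. 4. The homomorphism $A^{\otimes n}\cong\bigotimes_i A^{\otimes n_i}\to\bigotimes_i A_i^{\otimes n_i}$ induced by the projections descends to an isomorphism of $R$-algebras $C(A,\phi)\cong\bigotimes_i C(A_i,\phi_i)$. -/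

import Mathlib

open scoped TensorProduct

universe u v

noncomputable section

/-- `M` is locally free of rank `n` over `R`: the elements `r` of `R` for which `M_r` is free of
rank `n` over `R_r` generate the unit ideal. -/
def IsLocallyFreeOfRank (R : Type*) (M : Type*) [CommRing R] [AddCommGroup M] [Module R M]
    (n : ℕ) : Prop :=
  Ideal.span {r : R | Nonempty (LocalizedModule.Away r M ≃ₗ[Localization.Away r]
    (Fin n → Localization.Away r))} = ⊤

/-! ### Tensor products of finite families of commutative algebras -/

section Families

variable {R : Type*} [CommRing R] {ι : Type*} [Fintype ι]
  {B : ι → Type*} [∀ i, CommRing (B i)] [∀ i, Algebra R (B i)]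

/-- The homomorphism `⨂ᵢ Bᵢ → S`, `⊗ bᵢ ↦ ∏ᵢ fᵢ(bᵢ)`. -/
def piTensorLift {S : Type*} [CommRing S] [Algebra R S] (f : ∀ i, B i →ₐ[R] S) :
    (⨂[R] i, B i) →ₐ[R] S :=
  PiTensorProduct.liftAlgHom
    ((MultilinearMap.mkPiAlgebra R ι S).compLinearMap fun i => (f i).toLinearMap)
    (by simp) (by intro x y; simp [Finset.prod_mul_distrib])

theorem piTensorLift_tprod {S : Type*} [CommRing S] [Algebra R S] (f : ∀ i, B i →ₐ[R] S)
    (b : ∀ i, B i) : piTensorLift f (PiTensorProduct.tprod R b) = ∏ i, f i (b i) := by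
  unfold piTensorLift
  exact (PiTensorProduct.lift.tprod b).trans (by simp)

variable [DecidableEq ι]

theorem piTensorLift_single {S : Type*} [CommRing S] [Algebra R S] (f : ∀ i, B i →ₐ[R] S)
    (i : ι) (b : B i) : piTensorLift f (PiTensorProduct.singleAlgHom i b) = f i b := by
  rw [PiTensorProduct.singleAlgHom_apply, piTensorLift_tprod, Finset.prod_eq_single i]
  · simp
  · intro j _ hj
    simp [Pi.mulSingle_eq_of_ne hj]
  · simp

/-- The homomorphism `⨂ᵢ fᵢ : ⨂ᵢ Bᵢ → ⨂ᵢ Cᵢ`. -/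
def piTensorMap {C : ι → Type*} [∀ i, CommRing (C i)] [∀ i, Algebra R (C i)]
    (f : ∀ i, B i →ₐ[R] C i) : (⨂[R] i, B i) →ₐ[R] ⨂[R] i, C i :=
  piTensorLift fun i => (PiTensorProduct.singleAlgHom i).comp (f i)

end Families

/-! ### Tensor powers and invariants -/

/-- The `n`-th tensor power `A^{⊗n}` over `R`. -/
abbrev TensorPow (R : Type*) (A : Type*) [CommRing R] [CommRing A] [Algebra R A] (n : ℕ) :=
  ⨂[R] _ : Fin n, A

section Powers

variable (R : Type*) {A : Type*} [CommRing R] [CommRing A] [Algebra R A]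

/-- The element `a^{(j)} = 1 ⊗ ⋯ ⊗ a ⊗ ⋯ ⊗ 1`, as a homomorphism in `a`. -/
abbrev conjFactor {n : ℕ} (j : Fin n) : A →ₐ[R] TensorPow R A n :=
  PiTensorProduct.singleAlgHom (A := fun _ : Fin n => A) j

/-- The permutation `σ` acting on the factors: it moves the `j`-th factor to place `σ j`. -/
def permFactors (A : Type*) [CommRing A] [Algebra R A] {n : ℕ} (σ : Equiv.Perm (Fin n)) :
    TensorPow R A n →ₐ[R] TensorPow R A n :=
  piTensorLift fun j => conjFactor R (σ j)

/-- The algebra of invariants `(A^{⊗n})^G`, for a subgroup `G` of the symmetric group. -/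
def fixedPow (A : Type*) [CommRing A] [Algebra R A] {n : ℕ} (G : Subgroup (Equiv.Perm (Fin n))) :
    Subalgebra R (TensorPow R A n) where
  carrier := {t | ∀ σ ∈ G, permFactors R A σ t = t}
  mul_mem' ha hb σ hσ := by rw [map_mul, ha σ hσ, hb σ hσ]
  add_mem' ha hb σ hσ := by rw [map_add, ha σ hσ, hb σ hσ]
  algebraMap_mem' r σ _ := AlgHom.commutes _ r

/-- For `H ≤ G`, the inclusion of the `G`-invariants into the `H`-invariants. -/
def fixedPowInclusion (A : Type*) [CommRing A] [Algebra R A] {n : ℕ}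
    {H G : Subgroup (Equiv.Perm (Fin n))} (h : H ≤ G) : fixedPow R A G →ₐ[R] fixedPow R A H :=
  Subalgebra.inclusion fun _ ht σ hσ => ht σ (h hσ)

theorem permFactors_tprod {n : ℕ} (σ : Equiv.Perm (Fin n)) (a : Fin n → A) :
    permFactors R A σ (PiTensorProduct.tprod R a) =
      PiTensorProduct.tprod R fun j => a (σ.symm j) := by
  unfold permFactors
  rw [piTensorLift_tprod]
  simp only [PiTensorProduct.singleAlgHom_apply]
  rw [← PiTensorProduct.tprod_prod]
  congr 1
  funext j
  rw [Finset.prod_apply, Finset.prod_eq_single (σ.symm j)]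
  · simp
  · intro i _ hi
    have : j ≠ σ i := fun h => hi (by simp [h])
    simp [Pi.mulSingle_eq_of_ne this]
  · simp

variable {R}

/-- A homomorphism `f : A → B` induces `f^{⊗n} : A^{⊗n} → B^{⊗n}`. -/
def mapPow {B : Type*} [CommRing B] [Algebra R B] (f : A →ₐ[R] B) (n : ℕ) :
    TensorPow R A n →ₐ[R] TensorPow R B n :=
  piTensorMap fun _ => f

theorem permFactors_mapPow {B : Type*} [CommRing B] [Algebra R B] (f : A →ₐ[R] B) {n : ℕ}
    (σ : Equiv.Perm (Fin n)) (t : TensorPow R A n) :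
    permFactors R B σ (mapPow f n t) = mapPow f n (permFactors R A σ t) := by
  have : (permFactors R B σ).comp (mapPow f n) = (mapPow f n).comp (permFactors R A σ) := by
    apply PiTensorProduct.algHom_ext
    intro j
    ext a
    simp only [AlgHom.comp_apply, mapPow, piTensorMap, permFactors, piTensorLift_single]
  exact DFunLike.congr_fun this t

/-- The homomorphism `(A^{⊗n})^G → (B^{⊗n})^G` induced by `f : A → B`. -/
def mapFixedPow {B : Type*} [CommRing B] [Algebra R B] (f : A →ₐ[R] B) {n : ℕ}
    (G : Subgroup (Equiv.Perm (Fin n))) : fixedPow R A G →ₐ[R] fixedPow R B G :=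
  ((mapPow f n).comp (fixedPow R A G).val).codRestrict (fixedPow R B G) fun t σ hσ => by
    show permFactors R B σ (mapPow f n t) = mapPow f n t
    rw [permFactors_mapPow, t.2 σ hσ]

end Powers

/-! ### The norm and the Ferrand homomorphism -/

section Ferrand

/-- The element `r` is the norm of `a ∈ A`, for `A` an `R`-algebra of rank `n`:
`(a a₁) ∧ ⋯ ∧ (a aₙ) = r (a₁ ∧ ⋯ ∧ aₙ)` for all `a₁, …, aₙ ∈ A`. -/
def IsNorm (R : Type*) {A : Type*} [CommRing R] [CommRing A] [Algebra R A] (n : ℕ)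
    (a : A) (r : R) : Prop :=
  ∀ v : Fin n → A,
    exteriorPower.ιMulti R n (fun j => a * v j) = r • exteriorPower.ιMulti R n v

/-- The invariant tensor `a ⊗ ⋯ ⊗ a`. -/
def diagPow (R : Type*) {A : Type*} [CommRing R] [CommRing A] [Algebra R A] {n : ℕ}
    (G : Subgroup (Equiv.Perm (Fin n))) (a : A) : fixedPow R A G :=
  ⟨PiTensorProduct.tprod R fun _ => a, fun σ _ => permFactors_tprod R σ fun _ => a⟩

variable {R : Type u} {A : Type v} [CommRing R] [CommRing A] [Algebra R A]

/-- The natural homomorphism `A^{⊗n} → A'^{⊗n}`, where `A' = R' ⊗ A` and the second tensor power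
is over `R'`. -/
def baseChangePow (R' : Type*) [CommRing R'] [Algebra R R'] (n : ℕ) :
    TensorPow R A n →ₐ[R] TensorPow R' (R' ⊗[R] A) n :=
  piTensorLift fun j =>
    ((conjFactor R' j).restrictScalars R).comp Algebra.TensorProduct.includeRight

theorem permFactors_baseChangePow (R' : Type*) [CommRing R'] [Algebra R R'] {n : ℕ}
    (σ : Equiv.Perm (Fin n)) (t : TensorPow R A n) :
    permFactors R' (R' ⊗[R] A) σ (baseChangePow R' n t) =
      baseChangePow R' n (permFactors R A σ t) := by
  have : ((permFactors R' (R' ⊗[R] A) σ).restrictScalars R).comp (baseChangePow R' n) =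
      (baseChangePow R' n).comp (permFactors R A σ) := by
    apply PiTensorProduct.algHom_ext
    intro j
    ext a
    simp only [AlgHom.comp_apply, AlgHom.restrictScalars_apply, baseChangePow, permFactors,
      piTensorLift_single]
  exact DFunLike.congr_fun this t

/-- The natural homomorphism `(A^{⊗n})^G → (A'^{⊗n})^G`, where `A' = R' ⊗ A`. -/
def baseChangeFixedPow (R' : Type*) [CommRing R'] [Algebra R R'] {n : ℕ}
    (G : Subgroup (Equiv.Perm (Fin n))) :
    fixedPow R A G →ₐ[R] fixedPow R' (R' ⊗[R] A) G :=
  ((baseChangePow R' n).comp (fixedPow R A G).val).codRestrict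
    ((fixedPow R' (R' ⊗[R] A) G).restrictScalars R) fun t σ hσ => by
      show permFactors R' (R' ⊗[R] A) σ (baseChangePow R' n t) = baseChangePow R' n t
      rw [permFactors_baseChangePow, t.2 σ hσ]

/-- `F` is the Ferrand homomorphism of the rank-`n` algebra `A`, that is, the homomorphism
corresponding to the norm as a polynomial law: over every base change `A' = R' ⊗ A` it is
compatible with a homomorphism `F'` of `R'`-algebras that sends every `a ⊗ ⋯ ⊗ a` to the norm
of `a` (over `R' = R`, this says that `F` itself does so). These conditions determine `F`. -/
def IsFerrandHom {n : ℕ} (F : fixedPow R A (⊤ : Subgroup (Equiv.Perm (Fin n))) →ₐ[R] R) : Prop :=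
  ∀ (R' : Type u) [CommRing R'] [Algebra R R'],
    ∃ F' : fixedPow R' (R' ⊗[R] A) (⊤ : Subgroup (Equiv.Perm (Fin n))) →ₐ[R'] R',
      (∀ a : R' ⊗[R] A, IsNorm R' n a (F' (diagPow R' ⊤ a))) ∧
      ∀ t, F' (baseChangeFixedPow R' ⊤ t) = algebraMap R R' (F t)

/-- `φ : (A^{⊗n})^G → R` is a `G`-closure datum for the rank-`n` algebra `A`: its restriction to
the invariants of the full symmetric group is the Ferrand homomorphism. -/
def IsClosureDatum {n : ℕ} {G : Subgroup (Equiv.Perm (Fin n))} (φ : fixedPow R A G →ₐ[R] R) :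
    Prop :=
  IsFerrandHom (φ.comp (fixedPowInclusion R A (le_top : G ≤ ⊤)))

end Ferrand

/-! ### Closure algebras -/

section Closure

variable {R : Type*} {A : Type*} [CommRing R] [CommRing A] [Algebra R A] {n : ℕ}
  {G : Subgroup (Equiv.Perm (Fin n))}

/-- The ring `R`, regarded as an algebra over `(A^{⊗n})^G` by means of `φ`. -/
@[nolint unusedArguments]
def ScalarsVia (_φ : fixedPow R A G →ₐ[R] R) := R

instance (φ : fixedPow R A G →ₐ[R] R) : CommRing (ScalarsVia φ) := inferInstanceAs (CommRing R)

instance (φ : fixedPow R A G →ₐ[R] R) : Algebra (fixedPow R A G) (ScalarsVia φ) :=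
  φ.toRingHom.toAlgebra

/-- The closure algebra `A^{⊗n} ⊗ R` over `(A^{⊗n})^G` associated with `φ`. -/
abbrev ClosureAlgebra (φ : fixedPow R A G →ₐ[R] R) :=
  TensorPow R A n ⊗[fixedPow R A G] ScalarsVia φ

/-- The canonical homomorphism from `A^{⊗n}` to the closure algebra, `t ↦ t ⊗ 1`. -/
def toClosure (φ : fixedPow R A G →ₐ[R] R) : TensorPow R A n →ₐ[R] ClosureAlgebra φ :=
  Algebra.TensorProduct.includeLeft

end Closure

/-! ### Products -/

section Product

/-- The subgroup `∏ᵢ Gᵢ` of the symmetric group on `n₁ + ⋯ + n_k` letters, where `Gᵢ` permutes the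
`i`-th block `{n₁ + ⋯ + n_{i-1} + 1, …, n₁ + ⋯ + n_{i-1} + nᵢ}`. -/
def prodSubgroup {k : ℕ} {n : Fin k → ℕ} (G : ∀ i, Subgroup (Equiv.Perm (Fin (n i)))) :
    Subgroup (Equiv.Perm (Fin (∑ i, n i))) :=
  (Subgroup.pi Set.univ G).map
    (((finSigmaFinEquiv (n := n)).permCongrHom.toMonoidHom).comp
      (Equiv.Perm.sigmaCongrRightHom fun i => Fin (n i)))

variable {R : Type*} [CommRing R] {k : ℕ} {n : Fin k → ℕ}

section Single

variable (R) (B : Type*) [CommRing B] [Algebra R B]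

/-- The homomorphism `B^{⊗nᵢ} → B^{⊗n}` that puts the tensor factors into the `i`-th block. -/
def blockIncl (n : Fin k → ℕ) (i : Fin k) : TensorPow R B (n i) →ₐ[R] TensorPow R B (∑ i, n i) :=
  piTensorLift fun j => conjFactor R (finSigmaFinEquiv ⟨i, j⟩)

/-- The isomorphism `B^{⊗n} → ⨂ᵢ B^{⊗nᵢ}` that groups the tensor factors into blocks. -/
def regroup (n : Fin k → ℕ) : TensorPow R B (∑ i, n i) →ₐ[R] ⨂[R] i, TensorPow R B (n i) :=
  piTensorLift fun p =>
    (PiTensorProduct.singleAlgHom (A := fun i => TensorPow R B (n i))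
      (finSigmaFinEquiv.symm p).1).comp (conjFactor R (finSigmaFinEquiv.symm p).2)

theorem permFactors_blockIncl (g : ∀ i, Equiv.Perm (Fin (n i))) (i : Fin k)
    (t : TensorPow R B (n i)) :
    permFactors R B (finSigmaFinEquiv.permCongrHom (Equiv.Perm.sigmaCongrRightHom _ g))
      (blockIncl R B n i t) = blockIncl R B n i (permFactors R B (g i) t) := by
  have : (permFactors R B (finSigmaFinEquiv.permCongrHom
        (Equiv.Perm.sigmaCongrRightHom _ g))).comp (blockIncl R B n i) =
      (blockIncl R B n i).comp (permFactors R B (g i)) := by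
    apply PiTensorProduct.algHom_ext
    intro j
    ext a
    simp only [AlgHom.comp_apply, blockIncl, permFactors, piTensorLift_single]
    simp [Equiv.permCongrHom]
  exact DFunLike.congr_fun this t

/-- The natural homomorphism `⨂ᵢ (B^{⊗nᵢ})^{Gᵢ} → (B^{⊗n})^{∏ Gᵢ}`, the restriction of the
isomorphism `⨂ᵢ B^{⊗nᵢ} → B^{⊗n}`. -/
def fixedPowProd (G : ∀ i, Subgroup (Equiv.Perm (Fin (n i)))) :
    (⨂[R] i, fixedPow R B (G i)) →ₐ[R] fixedPow R B (prodSubgroup G) :=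
  piTensorLift fun i =>
    ((blockIncl R B n i).comp (fixedPow R B (G i)).val).codRestrict
      (fixedPow R B (prodSubgroup G)) fun t σ hσ => by
        obtain ⟨g, hg, rfl⟩ := hσ
        show permFactors R B (finSigmaFinEquiv.permCongrHom
          (Equiv.Perm.sigmaCongrRightHom _ g)) (blockIncl R B n i t) = blockIncl R B n i t
        rw [permFactors_blockIncl, t.2 (g i) (hg i (Set.mem_univ i))]

end Single

variable (A : Fin k → Type*) [∀ i, CommRing (A i)] [∀ i, Algebra R (A i)]

/-- The projection `A = ∏ᵢ Aᵢ → Aᵢ`. -/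
abbrev projA (R : Type*) [CommRing R] [∀ i, Algebra R (A i)] (i : Fin k) : (∀ i, A i) →ₐ[R] A i :=
  Pi.evalAlgHom R A i

/-- The homomorphism `A^{⊗n} ≅ ⨂ᵢ A^{⊗nᵢ} → ⨂ᵢ Aᵢ^{⊗nᵢ}`, where `A = ∏ᵢ Aᵢ`. -/
def powToTensor (R : Type*) [CommRing R] [∀ i, Algebra R (A i)] (n : Fin k → ℕ) :
    TensorPow R (∀ i, A i) (∑ i, n i) →ₐ[R] ⨂[R] i, TensorPow R (A i) (n i) :=
  (piTensorMap fun i => mapPow (projA A R i) (n i)).comp (regroup R (∀ i, A i) n)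

/-- The homomorphism `⨂ᵢ (A^{⊗nᵢ})^{Gᵢ} → ⨂ᵢ (Aᵢ^{⊗nᵢ})^{Gᵢ}`, where `A = ∏ᵢ Aᵢ`. -/
def fixedToTensor (R : Type*) [CommRing R] [∀ i, Algebra R (A i)]
    (G : ∀ i, Subgroup (Equiv.Perm (Fin (n i)))) :
    (⨂[R] i, fixedPow R (∀ i, A i) (G i)) →ₐ[R] ⨂[R] i, fixedPow R (A i) (G i) :=
  piTensorMap fun i => mapFixedPow (projA A R i) (G i)

variable {A}

/-- The composite `(A^{⊗n})^G ≅ ⨂ᵢ (A^{⊗nᵢ})^{Gᵢ} → ⨂ᵢ (Aᵢ^{⊗nᵢ})^{Gᵢ} → R`, the last map being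
`⨂ᵢ φᵢ`, where `A = ∏ᵢ Aᵢ` and `G = ∏ᵢ Gᵢ`. -/
def prodDatum {G : ∀ i, Subgroup (Equiv.Perm (Fin (n i)))} (φ : ∀ i, fixedPow R (A i) (G i) →ₐ[R] R)
    (h : Function.Bijective (fixedPowProd R (∀ i, A i) G)) :
    fixedPow R (∀ i, A i) (prodSubgroup G) →ₐ[R] R :=
  ((piTensorLift φ).comp (fixedToTensor A R G)).comp
    (AlgEquiv.ofBijective (fixedPowProd R (∀ i, A i) G) h).symm.toAlgHom

end Product

end

/-!
Let `A = ∏ᵢ Aᵢ` and `G = ∏ᵢ Gᵢ`, and let `φ` be the homomorphism built from the `φᵢ`.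

*Invariants.* The map `⨂ᵢ (B^{⊗nᵢ})^{Gᵢ} → (B^{⊗n})^G` is bijective for every algebra `B` that is
finite projective as a module (`fixedPowProd_bijective`). Tensor powers are functorial in linear
maps, so `B` may be embedded as a direct summand in `F = R^N`. There `F^{⊗m}` is the module of
functions on a finite set of points, permuted by the group, and evaluating at a chosen
representative of each orbit is a linear projection onto the invariants (`orbitProj`). These
projections make the inclusions of the invariants split, whence injectivity. The tensor product of
the projections for the `Gᵢ` fixes every `G`-invariant, since the tuple of representatives of the
blocks of a point lies in the `G`-orbit of the point, whence surjectivity. The projection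
`A → Aᵢ` has a linear section, so that it is surjective on invariants.

*Norm.* The norm of `a ∈ A` is the product of the norms of its components (`IsNorm.pi`). Expand
`v₁ ∧ ⋯ ∧ vₙ` with respect to `A = ∏ᵢ Aᵢ`. An alternating map in more than `nᵢ` arguments from `Aᵢ`
vanishes, because `Aᵢ` is locally spanned by `nᵢ` elements. Hence only those terms survive that have
exactly `nᵢ` arguments in each `Aᵢ`, and multiplication by `a` scales such a term by the norms of
the components. Now let `R'` be an `R`-algebra. Over `R'` the homomorphisms supplied for the
factors combine to one for `∏ᵢ R' ⊗ Aᵢ = R' ⊗ A` in the same way as the `φᵢ` combine to `φ`. As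
an `Sₙ`-invariant tensor is invariant under the full symmetric group of each block, both can be
compared on `⨂ᵢ (A^{⊗nᵢ})^{S_{nᵢ}}`, and `φ` extends the Ferrand homomorphism
(`isClosureDatum_prodDatum`).

*Closure algebras.* The closure algebra of `φ` is the quotient of `A^{⊗n}` by the relations
`t = φ(t)`, for invariant `t` (`IsClosureMap`). Let `e ∈ A` be the idempotent with component `1` in
`Aᵢ` and `0` elsewhere. The tensor with `e` at all places of the `i`-th block is invariant and
`φ` sends it to `1`, so each of these factors `e` becomes `1` in the closure algebra
(`IsClosureMap.map_single_one`). Therefore every factor of the `i`-th block maps to it through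
`Aᵢ`, and this yields the inverse of the natural homomorphism to `⨂ᵢ C(Aᵢ, φᵢ)`
(`IsClosureMap.exists_algEquiv`).
-/

/-! ### Modules that are locally free of a given rank -/

section LocallyFree

variable {R : Type*} [CommRing R] {M : Type*} [AddCommGroup M] [Module R M]

/-- The finite family `e` becomes a basis of `M_r` over `R_r`, expressed without localizing:
up to powers of `r`, the family spans `M` and is linearly independent. -/
structure IsBasisAway {κ : Type*} [Fintype κ] (r : R) (e : κ → M) : Prop where
  mem_span : ∀ v : M, ∃ k : ℕ, r ^ k • v ∈ Submodule.span R (Set.range e)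
  eq_zero : ∀ c : κ → R, ∑ j, c j • e j = 0 → ∃ k : ℕ, ∀ j, r ^ k * c j = 0

theorem IsBasisAway.of_dvd {κ : Type*} [Fintype κ] {r s : R} {e : κ → M} (h : IsBasisAway r e)
    (hrs : r ∣ s) : IsBasisAway s e := by
  obtain ⟨t, rfl⟩ := hrs
  constructor
  · intro v
    obtain ⟨k, hk⟩ := h.mem_span v
    exact ⟨k, by rw [mul_pow, mul_comm, mul_smul]; exact Submodule.smul_mem _ _ hk⟩
  · intro c hc
    obtain ⟨k, hk⟩ := h.eq_zero c hc
    exact ⟨k, fun j => by rw [mul_pow, mul_right_comm, hk j, zero_mul]⟩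

theorem IsBasisAway.comp_equiv {κ κ' : Type*} [Fintype κ] [Fintype κ'] {r : R} {e : κ → M}
    (h : IsBasisAway r e) (f : κ' ≃ κ) : IsBasisAway r (e ∘ f) := by
  constructor
  · intro v
    rw [f.surjective.range_comp]
    exact h.mem_span v
  · intro c hc
    obtain ⟨k, hk⟩ := h.eq_zero (c ∘ f.symm) (by
      rw [← f.sum_comp]
      simpa using hc)
    exact ⟨k, fun j => by simpa using hk (f j)⟩

theorem IsBasisAway.pi {ι : Type*} [Fintype ι] [DecidableEq ι] {N : ι → Type*}
    [∀ i, AddCommGroup (N i)] [∀ i, Module R (N i)] {κ : ι → Type*} [∀ i, Fintype (κ i)] {r : R}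
    {e : ∀ i, κ i → N i} (h : ∀ i, IsBasisAway r (e i)) :
    IsBasisAway r fun p : Σ i, κ i => (Pi.single p.1 (e p.1 p.2) : ∀ i, N i) := by
  constructor
  · intro v
    choose k hk using fun i => (h i).mem_span (v i)
    refine ⟨∑ i, k i, ?_⟩
    rw [← Finset.univ_sum_single ((r ^ ∑ i, k i) • v)]
    refine Submodule.sum_mem _ fun i _ => ?_
    have hi : (r ^ ∑ i, k i) • v i ∈ Submodule.span R (Set.range (e i)) := by
      rw [← Finset.sum_erase_add _ _ (Finset.mem_univ i), pow_add, mul_smul]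
      exact Submodule.smul_mem _ _ (hk i)
    have := Submodule.mem_map_of_mem (f := LinearMap.single R N i) hi
    rw [Submodule.map_span, ← Set.range_comp] at this
    refine Submodule.span_mono ?_ this
    rintro _ ⟨j, rfl⟩
    exact ⟨⟨i, j⟩, rfl⟩
  · intro c hc
    have hi : ∀ i, ∑ j, c ⟨i, j⟩ • e i j = 0 := by
      intro i
      have := congrFun hc i
      rw [Fintype.sum_sigma, Finset.sum_apply, Finset.sum_eq_single i] at this
      · simpa using this
      · intro i' _ hi'
        simp [Pi.single_eq_of_ne hi'.symm]
      · simp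
    choose k hk using fun i => (h i).eq_zero _ (hi i)
    refine ⟨∑ i, k i, fun ⟨i, j⟩ => ?_⟩
    rw [← Finset.sum_erase_add _ _ (Finset.mem_univ i), pow_add, mul_assoc, hk i j, mul_zero]

theorem IsBasisAway.nonempty_linearEquiv {κ : Type*} [Fintype κ] {r : R} {e : κ → M}
    (h : IsBasisAway r e) : Nonempty (LocalizedModule.Away r M ≃ₗ[Localization.Away r]
      (κ → Localization.Away r)) := by
  let f : (κ → R) →ₗ[R] LocalizedModule.Away r M :=
    LocalizedModule.mkLinearMap (.powers r) M ∘ₗ Fintype.linearCombination R e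
  have : IsLocalizedModule.Away r f := by
    refine IsLocalizedModule.Away.mk_of_addCommGroup
      (IsLocalizedModule.Away.isUnit_algebraMap (LocalizedModule.mkLinearMap (.powers r) M) r)
      ?_ ?_
    · intro x
      obtain ⟨m, v, hv⟩ := IsLocalizedModule.Away.surj
        (LocalizedModule.mkLinearMap (.powers r) M) r x
      obtain ⟨k, hk⟩ := h.mem_span v
      rw [← Fintype.range_linearCombination R] at hk
      obtain ⟨c, hc⟩ := hk
      refine ⟨k + m, c, ?_⟩
      rw [pow_add, mul_smul, hv, ← map_smul, ← hc]
      rfl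
    · intro c hc
      obtain ⟨m, hm⟩ := IsLocalizedModule.Away.exists_of_eq r (f :=
        LocalizedModule.mkLinearMap (.powers r) M) (hc.trans (map_zero _).symm)
      rw [smul_zero, ← map_smul, Fintype.linearCombination_apply] at hm
      obtain ⟨k, hk⟩ := h.eq_zero _ hm
      refine ⟨k + m, funext fun j => ?_⟩
      rw [pow_add]
      simpa [mul_assoc] using hk j
  exact ⟨(IsLocalizedModule.linearEquiv (.powers r) f (LinearMap.pi fun i : κ =>
    Algebra.linearMap R (Localization.Away r) ∘ₗ LinearMap.proj i)).extendScalarsOfIsLocalization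
      (.powers r) _⟩

theorem exists_isBasisAway {κ : Type*} [Fintype κ] {r : R}
    (E : LocalizedModule.Away r M ≃ₗ[Localization.Away r] (κ → Localization.Away r)) :
    ∃ e : κ → M, IsBasisAway r e := by
  classical
  let g := LocalizedModule.mkLinearMap (.powers r) M
  have hr : ∀ k : ℕ, IsUnit (algebraMap R (Localization.Away r) r ^ k) := fun k =>
    (IsLocalization.Away.algebraMap_isUnit r).pow k
  choose k e he using fun j : κ => IsLocalizedModule.Away.surj g r (E.symm (Pi.single j 1))
  have he' : ∀ j, E (g (e j)) = Pi.single j (algebraMap R (Localization.Away r) r ^ k j) := by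
    intro j
    rw [← he, ← algebraMap_smul (Localization.Away r) (r ^ k j), map_smul,
      E.apply_symm_apply, ← Pi.single_smul]
    simp
  have hsum : ∀ c : κ → R, ∀ j, E (g (∑ j, c j • e j)) j =
      algebraMap R (Localization.Away r) (c j) * algebraMap R (Localization.Away r) r ^ k j := by
    intro c j
    simp only [map_sum, map_smul]
    rw [Finset.sum_apply, Finset.sum_eq_single j]
    · rw [← algebraMap_smul (Localization.Away r) (c j), map_smul, he']
      simp
    · intro i _ hi
      rw [← algebraMap_smul (Localization.Away r) (c i), map_smul, he']
      simp [Pi.single_eq_of_ne hi.symm]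
    · simp
  refine ⟨e, fun v => ?_, fun c hc => ?_⟩
  · -- the coordinates of `v` with respect to the `e j`, cleared of denominators
    obtain ⟨⟨_, m, rfl⟩, hm⟩ := IsLocalization.exist_integer_multiples_of_finite
      (Submonoid.powers r) fun j => E (g v) j * ((hr (k j)).unit⁻¹ : (Localization.Away r)ˣ)
    choose c hc using hm
    have : g (r ^ m • v) = g (∑ j, c j • e j) := by
      apply E.injective
      funext j
      rw [hsum, hc, map_smul, ← algebraMap_smul (Localization.Away r) (r ^ m), map_smul]
      simp only [Pi.smul_apply, smul_eq_mul, Algebra.smul_def, map_pow]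
      rw [mul_assoc, mul_assoc, IsUnit.val_inv_mul, mul_one]
    obtain ⟨m', hm'⟩ := IsLocalizedModule.Away.exists_of_eq r this
    refine ⟨m' + m, ?_⟩
    rw [pow_add, mul_smul, hm']
    exact Submodule.smul_mem _ _ (Submodule.sum_mem _ fun j _ =>
      Submodule.smul_mem _ _ (Submodule.subset_span ⟨j, rfl⟩))
  · have : ∀ j, ∃ m : ℕ, r ^ m * c j = 0 := by
      intro j
      have h0 := hsum c j
      rw [hc, map_zero, map_zero, Pi.zero_apply, eq_comm, (hr (k j)).mul_left_eq_zero] at h0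
      obtain ⟨⟨_, m, rfl⟩, hm⟩ := (IsLocalization.map_eq_zero_iff (.powers r) _ _).mp h0
      exact ⟨m, hm⟩
    choose m hm using this
    refine ⟨∑ j, m j, fun j => ?_⟩
    rw [← Finset.sum_erase_add _ _ (Finset.mem_univ j), pow_add, mul_assoc, hm, mul_zero]

theorem isLocallyFreeOfRank_iff {n : ℕ} :
    IsLocallyFreeOfRank R M n ↔
      Ideal.span {r : R | ∃ e : Fin n → M, IsBasisAway r e} = ⊤ := by
  have : {r : R | ∃ e : Fin n → M, IsBasisAway r e} = {r : R | Nonempty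
      (LocalizedModule.Away r M ≃ₗ[Localization.Away r] (Fin n → Localization.Away r))} := by
    ext r
    exact ⟨fun ⟨_, he⟩ => he.nonempty_linearEquiv, fun ⟨E⟩ => exists_isBasisAway E⟩
  rw [this, IsLocallyFreeOfRank]

/-- Finitely many sets closed under multiples that each generate the unit ideal meet in a set that
does so, too: outside of a maximal ideal, take the product of one element of each. -/
theorem span_iInter_eq_top {ι : Type*} [Fintype ι] {S : ι → Set R}
    (hmul : ∀ i, ∀ r ∈ S i, ∀ s, r ∣ s → s ∈ S i) (hS : ∀ i, Ideal.span (S i) = ⊤) :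
    Ideal.span (⋂ i, S i) = ⊤ := by
  by_contra h
  obtain ⟨m, hm, hle⟩ := Ideal.exists_le_maximal _ h
  have : ∀ i, ∃ r ∈ S i, r ∉ m := by
    intro i
    by_contra! hi
    exact hm.ne_top (top_le_iff.mp ((hS i).symm.le.trans (Ideal.span_le.mpr hi)))
  choose r hr hrm using this
  have hp : ∏ i, r i ∈ m := hle (Ideal.subset_span (Set.mem_iInter.mpr fun i =>
    hmul i _ (hr i) _ (Finset.dvd_prod_of_mem r (Finset.mem_univ i))))
  obtain ⟨i, -, hi⟩ := hm.isPrime.prod_mem_iff.mp hp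
  exact hrm i hi

theorem IsLocallyFreeOfRank.pi {k : ℕ} {n : Fin k → ℕ} {N : Fin k → Type*}
    [∀ i, AddCommGroup (N i)] [∀ i, Module R (N i)] (h : ∀ i, IsLocallyFreeOfRank R (N i) (n i)) :
    IsLocallyFreeOfRank R (∀ i, N i) (∑ i, n i) := by
  rw [isLocallyFreeOfRank_iff]
  refine top_le_iff.mp ((span_iInter_eq_top ?_ fun i =>
    isLocallyFreeOfRank_iff.mp (h i)).symm.le.trans (Ideal.span_mono fun r hr => ?_))
  · rintro i r ⟨e, he⟩ s hrs
    exact ⟨e, he.of_dvd hrs⟩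
  · choose e he using Set.mem_iInter.mp hr
    exact ⟨_, (IsBasisAway.pi he).comp_equiv finSigmaFinEquiv.symm⟩

theorem IsLocallyFreeOfRank.finitePresentation {n : ℕ} (h : IsLocallyFreeOfRank R M n) :
    Module.FinitePresentation R M := by
  refine Module.FinitePresentation.of_localizationSpan _ h fun ⟨r, hr⟩ => ?_
  obtain ⟨E⟩ := hr
  have := Module.Free.of_equiv E.symm
  have := Module.Finite.equiv E.symm
  exact Module.finitePresentation_of_projective _ _

theorem IsLocallyFreeOfRank.projective {n : ℕ} (h : IsLocallyFreeOfRank R M n) :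
    Module.Projective R M := by
  have := h.finitePresentation
  have : Module.Flat R M := by
    refine Module.flat_of_localized_span R M _ h fun ⟨r, hr⟩ => ?_
    obtain ⟨E⟩ := hr
    have := Module.Free.of_equiv E.symm
    have : Module.Flat R (Localization.Away r) := IsLocalization.flat _ (.powers r)
    exact Module.Flat.trans R (Localization.Away r) _
  exact Module.Flat.projective_of_finitePresentation

end LocallyFree

/-! ### Grouping the factors of a tensor power -/

section Regroup

variable {R : Type*} [CommRing R]

theorem prod_singleAlgHom {ι : Type*} [Fintype ι] [DecidableEq ι] {B : ι → Type*}
    [∀ i, CommRing (B i)] [∀ i, Algebra R (B i)] (b : ∀ i, B i) :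
    ∏ i, PiTensorProduct.singleAlgHom (R := R) i (b i) = PiTensorProduct.tprod R b := by
  simp only [PiTensorProduct.singleAlgHom_apply]
  rw [← PiTensorProduct.tprod_prod]
  exact congrArg _ (Finset.univ_prod_mulSingle b)

theorem piTensorMap_tprod {ι : Type*} [Fintype ι] [DecidableEq ι] {B C : ι → Type*}
    [∀ i, CommRing (B i)] [∀ i, Algebra R (B i)] [∀ i, CommRing (C i)] [∀ i, Algebra R (C i)]
    (f : ∀ i, B i →ₐ[R] C i) (b : ∀ i, B i) :
    piTensorMap f (PiTensorProduct.tprod R b) = PiTensorProduct.tprod R fun i => f i (b i) := by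
  rw [piTensorMap, piTensorLift_tprod]
  exact prod_singleAlgHom fun i => f i (b i)

variable {k : ℕ} (n : Fin k → ℕ)

section Algebra

variable (R) (B : Type*) [CommRing B] [Algebra R B]

/-- The homomorphism `⨂ᵢ B^{⊗nᵢ} → B^{⊗n}` that concatenates the blocks, inverse to `regroup`. -/
noncomputable def ungroup : (⨂[R] i, TensorPow R B (n i)) →ₐ[R] TensorPow R B (∑ i, n i) :=
  piTensorLift (blockIncl R B n)

theorem regroup_comp_ungroup : (regroup R B n).comp (ungroup R n B) = AlgHom.id R _ := by
  apply PiTensorProduct.algHom_ext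
  intro i
  apply PiTensorProduct.algHom_ext
  intro j
  ext b
  simp only [ungroup, regroup, blockIncl, piTensorLift_single, AlgHom.comp_apply, AlgHom.id_apply]
  rw [Equiv.symm_apply_apply]

theorem ungroup_comp_regroup : (ungroup R n B).comp (regroup R B n) = AlgHom.id R _ := by
  apply PiTensorProduct.algHom_ext
  intro p
  ext b
  simp [ungroup, regroup, blockIncl, piTensorLift_single, -PiTensorProduct.singleAlgHom_apply]

variable {R n B}

theorem regroup_ungroup (u : ⨂[R] i, TensorPow R B (n i)) : regroup R B n (ungroup R n B u) = u :=
  DFunLike.congr_fun (regroup_comp_ungroup R n B) u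

theorem ungroup_regroup (t : TensorPow R B (∑ i, n i)) : ungroup R n B (regroup R B n t) = t :=
  DFunLike.congr_fun (ungroup_comp_regroup R n B) t

variable (R n B) in
theorem regroup_bijective : Function.Bijective (regroup R B n) :=
  Function.bijective_iff_has_inverse.mpr ⟨ungroup R n B, ungroup_regroup, regroup_ungroup⟩

theorem regroup_tprod (b : Fin (∑ i, n i) → B) :
    regroup R B n (PiTensorProduct.tprod R b) = PiTensorProduct.tprod R fun i =>
      PiTensorProduct.tprod R fun j => b (finSigmaFinEquiv ⟨i, j⟩) := by
  rw [regroup, piTensorLift_tprod, ← finSigmaFinEquiv.prod_comp, Fintype.prod_sigma,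
    ← prod_singleAlgHom]
  refine Finset.prod_congr rfl fun i _ => ?_
  rw [← prod_singleAlgHom, map_prod]
  refine Finset.prod_congr rfl fun j _ => ?_
  rw [AlgHom.comp_apply, Equiv.symm_apply_apply]

theorem regroup_map {B' : Type*} [CommRing B'] [Algebra R B'] (f : B →ₗ[R] B')
    (t : TensorPow R B (∑ i, n i)) :
    regroup R B' n (PiTensorProduct.map (fun _ => f) t) =
      PiTensorProduct.map (fun _ => PiTensorProduct.map fun _ => f) (regroup R B n t) := by
  have : (regroup R B' n).toLinearMap ∘ₗ PiTensorProduct.map (fun _ => f) =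
      PiTensorProduct.map (fun _ => PiTensorProduct.map fun _ => f) ∘ₗ
        (regroup R B n).toLinearMap := by
    ext b
    simp [regroup_tprod]
  exact LinearMap.congr_fun this t

theorem ungroup_map {B' : Type*} [CommRing B'] [Algebra R B'] (f : B →ₗ[R] B')
    (u : ⨂[R] i, TensorPow R B (n i)) :
    ungroup R n B' (PiTensorProduct.map (fun _ => PiTensorProduct.map fun _ => f) u) =
      PiTensorProduct.map (fun _ => f) (ungroup R n B u) := by
  apply (regroup_bijective R n B').injective
  rw [regroup_ungroup, regroup_map, regroup_ungroup]

theorem coe_fixedPowProd (G : ∀ i, Subgroup (Equiv.Perm (Fin (n i))))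
    (u : ⨂[R] i, fixedPow R B (G i)) :
    (fixedPowProd R B G u : TensorPow R B (∑ i, n i)) =
      ungroup R n B (PiTensorProduct.map (fun i => (fixedPow R B (G i)).val.toLinearMap) u) := by
  have : (fixedPow R B (prodSubgroup G)).val.toLinearMap ∘ₗ (fixedPowProd R B G).toLinearMap =
      (ungroup R n B).toLinearMap ∘ₗ
        PiTensorProduct.map (fun i => (fixedPow R B (G i)).val.toLinearMap) := by
    ext b
    simp [fixedPowProd, ungroup, piTensorLift_tprod]
    rfl
  exact LinearMap.congr_fun this u

theorem permFactors_map {m : ℕ} (σ : Equiv.Perm (Fin m)) {B' : Type*} [CommRing B'] [Algebra R B']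
    (f : B →ₗ[R] B') (t : TensorPow R B m) :
    permFactors R B' σ (PiTensorProduct.map (fun _ => f) t) =
      PiTensorProduct.map (fun _ => f) (permFactors R B σ t) := by
  have : (permFactors R B' σ).toLinearMap ∘ₗ PiTensorProduct.map (fun _ => f) =
      PiTensorProduct.map (fun _ => f) ∘ₗ (permFactors R B σ).toLinearMap := by
    ext b
    simp [permFactors_tprod]
  exact LinearMap.congr_fun this t

theorem map_mem_fixedPow {m : ℕ} {G : Subgroup (Equiv.Perm (Fin m))} {B' : Type*} [CommRing B']
    [Algebra R B'] (f : B →ₗ[R] B') {t : TensorPow R B m} (ht : t ∈ fixedPow R B G) :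
    PiTensorProduct.map (fun _ => f) t ∈ fixedPow R B' G := fun σ hσ => by
  rw [permFactors_map, ht σ hσ]

end Algebra

/-! ### Invariants of tensor powers of a finite power of the base ring -/

section Orbits

variable {I : Type*} {m : ℕ}

/-- Two points of `I^m` are equivalent when a permutation from `G` carries one to the other. -/
def orbitSetoid (I : Type*) {m : ℕ} (G : Subgroup (Equiv.Perm (Fin m))) :
    Setoid (Fin m → I) where
  r x y := ∃ σ ∈ G, y = x ∘ σ
  iseqv :=
    { refl := fun x => ⟨1, G.one_mem, rfl⟩
      symm := by
        rintro x _ ⟨σ, hσ, rfl⟩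
        exact ⟨σ⁻¹, G.inv_mem hσ, by ext j; simp⟩
      trans := by
        rintro x _ _ ⟨σ, hσ, rfl⟩ ⟨τ, hτ, rfl⟩
        exact ⟨σ * τ, G.mul_mem hσ hτ, rfl⟩ }

/-- A chosen representative of the `G`-orbit of a point of `I^m`. -/
noncomputable def orbitRep (G : Subgroup (Equiv.Perm (Fin m))) (x : Fin m → I) :
    Fin m → I :=
  (Quotient.mk (orbitSetoid I G) x).out

theorem exists_orbitRep_eq (G : Subgroup (Equiv.Perm (Fin m))) (x : Fin m → I) :
    ∃ σ ∈ G, orbitRep G x = x ∘ σ :=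
  (orbitSetoid I G).symm (Quotient.mk_out (s := orbitSetoid I G) x)

theorem orbitRep_comp {G : Subgroup (Equiv.Perm (Fin m))} {σ : Equiv.Perm (Fin m)}
    (hσ : σ ∈ G) (x : Fin m → I) : orbitRep G (x ∘ σ) = orbitRep G x := by
  unfold orbitRep
  rw [Quotient.sound (s := orbitSetoid I G) (a := x) (b := x ∘ σ) ⟨σ, hσ, rfl⟩]

end Orbits

section Functions

section Evaluation

variable {I : Type*}

variable (R) in
/-- Evaluation at a point `x` of `I^m`. -/
noncomputable def evalPow {m : ℕ} (x : Fin m → I) : TensorPow R (I → R) m →ₐ[R] R :=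
  piTensorLift fun j => Pi.evalAlgHom R (fun _ => R) (x j)

theorem evalPow_permFactors {m : ℕ} (σ : Equiv.Perm (Fin m)) (t : TensorPow R (I → R) m)
    (x : Fin m → I) : evalPow R x (permFactors R (I → R) σ t) = evalPow R (x ∘ σ) t := by
  have : (evalPow R x).comp (permFactors R (I → R) σ) = evalPow R (x ∘ σ) := by
    apply PiTensorProduct.algHom_ext
    intro j
    ext b
    simp only [AlgHom.comp_apply, evalPow, permFactors, piTensorLift_single]
    rfl
  exact DFunLike.congr_fun this t

theorem evalPow_blockIncl (i : Fin k) (t : TensorPow R (I → R) (n i))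
    (x : Fin (∑ i, n i) → I) :
    evalPow R x (blockIncl R (I → R) n i t) =
      evalPow R (fun j => x (finSigmaFinEquiv ⟨i, j⟩)) t := by
  have : (evalPow R x).comp (blockIncl R (I → R) n i) =
      evalPow R (fun j => x (finSigmaFinEquiv ⟨i, j⟩)) := by
    apply PiTensorProduct.algHom_ext
    intro j
    ext b
    simp only [AlgHom.comp_apply, evalPow, blockIncl, piTensorLift_single]
  exact DFunLike.congr_fun this t

end Evaluation

variable (R) (I : Type*) [Fintype I] [DecidableEq I]

/-- For the algebra `F = R^I`, the tensor power `F^{⊗m}` consists of the functions on `I^m`. -/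
noncomputable def tensorPowFun (m : ℕ) :
    TensorPow R (I → R) m ≃ₗ[R] ((Fin m → I) → R) :=
  (Basis.piTensorProduct fun _ : Fin m => Pi.basisFun R I).equivFun

variable {R I}

theorem tensorPowFun_apply {m : ℕ} (t : TensorPow R (I → R) m) (x : Fin m → I) :
    tensorPowFun R I m t x = evalPow R x t := by
  have : LinearMap.proj x ∘ₗ (tensorPowFun R I m).toLinearMap =
      (evalPow R x).toLinearMap := by
    ext b
    simp [tensorPowFun, evalPow, piTensorLift_tprod, Basis.piTensorProduct_repr_tprod_apply]
  exact LinearMap.congr_fun this t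

theorem ext_evalPow {m : ℕ} {s t : TensorPow R (I → R) m}
    (h : ∀ x : Fin m → I, evalPow R x s = evalPow R x t) : s = t :=
  (tensorPowFun R I m).injective (funext fun x => by
    rw [tensorPowFun_apply, tensorPowFun_apply, h])

/-- The linear map replacing the value of a function on `I^m` at each point by its value at the
chosen representative of the orbit. It projects onto the invariants. -/
noncomputable def orbitProj {m : ℕ} (G : Subgroup (Equiv.Perm (Fin m))) :
    TensorPow R (I → R) m →ₗ[R] TensorPow R (I → R) m :=
  (tensorPowFun R I m).symm.toLinearMap ∘ₗ LinearMap.funLeft R R (orbitRep G) ∘ₗ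
    (tensorPowFun R I m).toLinearMap

theorem evalPow_orbitProj {m : ℕ} (G : Subgroup (Equiv.Perm (Fin m)))
    (t : TensorPow R (I → R) m) (x : Fin m → I) :
    evalPow R x (orbitProj G t) = evalPow R (orbitRep G x) t := by
  rw [← tensorPowFun_apply, ← tensorPowFun_apply]
  simp [orbitProj, LinearMap.funLeft_apply]

theorem orbitProj_mem {m : ℕ} (G : Subgroup (Equiv.Perm (Fin m))) (t : TensorPow R (I → R) m) :
    orbitProj G t ∈ fixedPow R (I → R) G := fun σ hσ => ext_evalPow fun x => by
  rw [evalPow_permFactors, evalPow_orbitProj, evalPow_orbitProj, orbitRep_comp hσ]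

theorem orbitProj_eq_self {m : ℕ} {G : Subgroup (Equiv.Perm (Fin m))}
    {t : TensorPow R (I → R) m} (ht : t ∈ fixedPow R (I → R) G) : orbitProj G t = t :=
  ext_evalPow fun x => by
    obtain ⟨σ, hσ, h⟩ := exists_orbitRep_eq G x
    rw [evalPow_orbitProj, h, ← evalPow_permFactors, ht σ hσ]

variable {n}

theorem evalPow_ungroup_map_orbitProj (G : ∀ i, Subgroup (Equiv.Perm (Fin (n i))))
    (u : ⨂[R] i, TensorPow R (I → R) (n i)) (x : Fin (∑ i, n i) → I) :
    evalPow R x (ungroup R n (I → R) (PiTensorProduct.map (fun i => orbitProj (G i)) u)) =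
      evalPow R (fun p => orbitRep (G (finSigmaFinEquiv.symm p).1)
        (fun j => x (finSigmaFinEquiv ⟨(finSigmaFinEquiv.symm p).1, j⟩))
          (finSigmaFinEquiv.symm p).2) (ungroup R n (I → R) u) := by
  have : (evalPow R x).toLinearMap ∘ₗ (ungroup R n (I → R)).toLinearMap ∘ₗ
      PiTensorProduct.map (fun i => orbitProj (G i)) =
      (evalPow R (fun p => orbitRep (G (finSigmaFinEquiv.symm p).1)
        (fun j => x (finSigmaFinEquiv ⟨(finSigmaFinEquiv.symm p).1, j⟩))
          (finSigmaFinEquiv.symm p).2)).toLinearMap ∘ₗ (ungroup R n (I → R)).toLinearMap := by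
    ext t
    simp [ungroup, piTensorLift_tprod, evalPow_blockIncl, evalPow_orbitProj]
    refine Finset.prod_congr rfl fun i _ => ?_
    congr 2
    funext j
    rw [Equiv.symm_apply_apply]
  exact LinearMap.congr_fun this u

/-- The representatives of the blocks of a point form a point of the same `∏ᵢ Gᵢ`-orbit, so that the
tensor product of the projections fixes the invariants. -/
theorem ungroup_map_orbitProj_regroup {G : ∀ i, Subgroup (Equiv.Perm (Fin (n i)))}
    {t : TensorPow R (I → R) (∑ i, n i)} (ht : t ∈ fixedPow R (I → R) (prodSubgroup G)) :
    ungroup R n (I → R) (PiTensorProduct.map (fun i => orbitProj (G i)) (regroup R (I → R) n t)) =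
      t := by
  refine ext_evalPow fun x => ?_
  rw [evalPow_ungroup_map_orbitProj, ungroup_regroup]
  choose σ hσ h using fun i =>
    exists_orbitRep_eq (G i) (fun j => x (finSigmaFinEquiv ⟨i, j⟩))
  have hmem : finSigmaFinEquiv.permCongrHom (Equiv.Perm.sigmaCongrRightHom _ σ) ∈
      prodSubgroup G := ⟨σ, fun i _ => hσ i, rfl⟩
  conv_rhs => rw [← ht _ hmem, evalPow_permFactors]
  congr 1
  congr 1
  funext p
  obtain ⟨⟨i, j⟩, rfl⟩ := finSigmaFinEquiv.surjective p
  simp only [h, Function.comp_apply, Equiv.permCongrHom, MulEquiv.coe_mk, Equiv.permCongr_apply,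
    Equiv.Perm.sigmaCongrRightHom_apply, Equiv.symm_apply_apply]
  rw [Equiv.symm_apply_apply]
  rfl

end Functions

/-! ### Invariants of tensor powers of a finite projective algebra -/

variable {n}

/-- For an algebra that is a finite projective module, taking invariants in the blocks commutes
with the tensor product. -/
theorem fixedPowProd_bijective (B : Type*) [CommRing B] [Algebra R B] [Module.Finite R B]
    [Module.Projective R B] (G : ∀ i, Subgroup (Equiv.Perm (Fin (n i)))) :
    Function.Bijective (fixedPowProd R B G) := by
  obtain ⟨N, p, s, -, -, hps⟩ := Module.Finite.exists_comp_eq_id_of_projective R B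
  have hmap : ∀ (m : ℕ) (t : TensorPow R B m), PiTensorProduct.map (fun _ => p)
      (PiTensorProduct.map (fun _ => s) t) = t := fun m t => by
    rw [← LinearMap.comp_apply, ← PiTensorProduct.map_comp, hps, PiTensorProduct.map_id,
      LinearMap.id_apply]
  -- the projection onto the invariants, transported from `R^N` to its direct summand `B`
  let ρ : ∀ i, TensorPow R B (n i) →ₗ[R] fixedPow R B (G i) := fun i =>
    (PiTensorProduct.map (fun _ => p) ∘ₗ orbitProj (G i) ∘ₗ
      PiTensorProduct.map (fun _ => s)).codRestrict (Subalgebra.toSubmodule (fixedPow R B (G i)))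
        fun t => map_mem_fixedPow p (orbitProj_mem _ _)
  have hρ : ∀ i, ρ i ∘ₗ (fixedPow R B (G i)).val.toLinearMap = LinearMap.id := by
    intro i
    refine LinearMap.ext fun t => Subtype.ext ?_
    change PiTensorProduct.map (fun _ => p) (orbitProj (G i)
      (PiTensorProduct.map (fun _ => s) (t : TensorPow R B (n i)))) = t
    rw [orbitProj_eq_self (map_mem_fixedPow s t.2), hmap]
  constructor
  · intro u u' h
    have h' := congrArg Subtype.val h
    rw [coe_fixedPowProd, coe_fixedPowProd] at h'
    have h'' := congrArg (PiTensorProduct.map ρ ∘ regroup R B n) h'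
    simpa only [Function.comp_apply, regroup_ungroup, ← LinearMap.comp_apply,
      ← PiTensorProduct.map_comp, hρ, PiTensorProduct.map_id, LinearMap.id_apply] using h''
  · intro t
    refine ⟨PiTensorProduct.map ρ (regroup R B n t), Subtype.ext ?_⟩
    rw [coe_fixedPowProd, ← LinearMap.comp_apply, ← PiTensorProduct.map_comp]
    have : (fun i => (fixedPow R B (G i)).val.toLinearMap ∘ₗ ρ i) = fun i =>
        PiTensorProduct.map (fun _ => p) ∘ₗ orbitProj (G i) ∘ₗ
          PiTensorProduct.map (fun _ => s) := rfl
    rw [this, PiTensorProduct.map_comp, LinearMap.comp_apply, ungroup_map,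
      PiTensorProduct.map_comp, LinearMap.comp_apply, ← regroup_map,
      ungroup_map_orbitProj_regroup (map_mem_fixedPow s t.2), hmap]

end Regroup

/-! ### Alternating maps on locally free modules -/

section Alternating

variable {R : Type*} [CommRing R] {M : Type*} [AddCommGroup M] [Module R M]

/-- Locally on the spectrum of `R`, the module `M` is spanned by `n` elements. This is
the part of local freeness of rank `n` that bounds the degree of the nonzero alternating maps on
`M`. -/
def IsLocallySpanned (R M : Type*) [CommRing R] [AddCommGroup M] [Module R M] (n : ℕ) : Prop :=
  Ideal.span {r : R | ∃ e : Fin n → M, ∀ v : M, ∃ k : ℕ,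
    r ^ k • v ∈ Submodule.span R (Set.range e)} = ⊤

theorem IsLocallyFreeOfRank.isLocallySpanned {n : ℕ} (h : IsLocallyFreeOfRank R M n) :
    IsLocallySpanned R M n :=
  top_le_iff.mp ((isLocallyFreeOfRank_iff.mp h).symm.le.trans
    (Ideal.span_mono fun _ ⟨e, he⟩ => ⟨e, he.mem_span⟩))

theorem IsLocallySpanned.baseChange {n : ℕ} (h : IsLocallySpanned R M n) (S : Type*) [CommRing S]
    [Algebra R S] : IsLocallySpanned S (S ⊗[R] M) n := by
  rw [IsLocallySpanned, ← top_le_iff, ← Ideal.map_top (algebraMap R S), ← h, Ideal.map_span]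
  refine Ideal.span_mono ?_
  rintro _ ⟨r, ⟨e, he⟩, rfl⟩
  refine ⟨fun j => 1 ⊗ₜ e j, fun v => ?_⟩
  induction v with
  | zero => exact ⟨0, by simp⟩
  | tmul s m =>
    obtain ⟨k, hk⟩ := he m
    refine ⟨k, ?_⟩
    have hmem : (1 : S) ⊗ₜ[R] (r ^ k • m) ∈
        (Submodule.span S (Set.range fun j => (1 : S) ⊗ₜ[R] e j)).restrictScalars R := by
      have := Submodule.mem_map_of_mem (f := TensorProduct.mk R S M 1) hk
      rw [Submodule.map_span, ← Set.range_comp] at this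
      exact Submodule.span_le_restrictScalars R S _ this
    have : algebraMap R S r ^ k • s ⊗ₜ[R] m = s • ((1 : S) ⊗ₜ[R] (r ^ k • m)) := by
      rw [TensorProduct.smul_tmul', TensorProduct.smul_tmul', TensorProduct.tmul_smul,
        TensorProduct.smul_tmul', ← map_pow, smul_eq_mul, smul_eq_mul, mul_one, Algebra.smul_def]
    rw [this]
    exact Submodule.smul_mem _ _ hmem
  | add x y hx hy =>
    obtain ⟨a, ha⟩ := hx
    obtain ⟨b, hb⟩ := hy
    refine ⟨a + b, ?_⟩
    rw [smul_add]
    refine Submodule.add_mem _ ?_ ?_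
    · rw [add_comm, pow_add, mul_smul]
      exact Submodule.smul_mem _ _ ha
    · rw [pow_add, mul_smul]
      exact Submodule.smul_mem _ _ hb

/-- A nonzero alternating map on a module that is locally spanned by `n` elements has at most `n`
arguments. -/
theorem IsLocallySpanned.alternatingMap_eq_zero {n : ℕ} (h : IsLocallySpanned R M n) {ι : Type*}
    [Fintype ι] (hn : n < Fintype.card ι) {N : Type*} [AddCommGroup N] [Module R N]
    (f : M [⋀^ι]→ₗ[R] N) : f = 0 := by
  classical
  ext v
  -- the annihilator of `f v` contains a power of each of the elements that generate `R`
  have htop : (Ideal.torsionOf R N (f v)).radical = ⊤ := by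
    refine top_le_iff.mp (h.symm.le.trans (Ideal.span_le.mpr ?_))
    rintro r ⟨e, he⟩
    choose k hk using fun j => he (v j)
    have hK : ∀ j, ∃ c, Fintype.linearCombination R e c = r ^ (∑ j, k j) • v j := by
      intro j
      rw [← LinearMap.mem_range, Fintype.range_linearCombination,
        ← Finset.sum_erase_add _ _ (Finset.mem_univ j), pow_add, mul_smul]
      exact Submodule.smul_mem _ _ (hk j)
    choose c hc using hK
    have hzero : f.compLinearMap (Fintype.linearCombination R e) = 0 := by
      refine Module.Basis.ext_alternating (Pi.basisFun R (Fin n)) fun w hw => ?_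
      have := Fintype.card_le_of_injective w hw
      rw [Fintype.card_fin] at this
      omega
    refine ⟨(∑ j, k j) * Fintype.card ι, ?_⟩
    rw [Ideal.mem_torsionOf_iff, pow_mul]
    have := AlternatingMap.congr_fun hzero c
    rw [AlternatingMap.compLinearMap_apply] at this
    simp only [hc] at this
    rw [← AlternatingMap.coe_multilinearMap, MultilinearMap.map_smul_univ] at this
    simpa using this
  rw [Ideal.radical_eq_top, Ideal.eq_top_iff_one, Ideal.mem_torsionOf_iff, one_smul] at htop
  exact htop

/-- Multiplication of every argument by an element of norm `r` multiplies any alternating map in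
`n` arguments by `r`. -/
theorem IsNorm.map_mul {A : Type*} [CommRing A] [Algebra R A] {n : ℕ} {a : A} {r : R}
    (h : IsNorm R n a r) {ι : Type*} [Fintype ι] (hn : Fintype.card ι = n) {N : Type*}
    [AddCommGroup N] [Module R N] (f : A [⋀^ι]→ₗ[R] N) (v : ι → A) :
    f (fun j => a * v j) = r • f v := by
  classical
  let e : ι ≃ Fin n := Fintype.equivFinOfCardEq hn
  have := congrArg (exteriorPower.alternatingMapLinearEquiv (f.domDomCongr e)) (h (v ∘ e.symm))
  rw [map_smul, exteriorPower.alternatingMapLinearEquiv_apply_ιMulti,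
    exteriorPower.alternatingMapLinearEquiv_apply_ιMulti] at this
  simpa [AlternatingMap.domDomCongr_apply, Function.comp_def] using this

/-- An alternating map with the arguments outside of `P` held fixed. -/
def AlternatingMap.domDomRestrict {ι : Type*} {N : Type*} [AddCommGroup N] [Module R N]
    (f : M [⋀^ι]→ₗ[R] N) (P : ι → Prop) [DecidablePred P] (z : {j // ¬P j} → M) :
    M [⋀^{j // P j}]→ₗ[R] N where
  __ := f.toMultilinearMap.domDomRestrict P z
  map_eq_zero_of_eq' v i j h hij := by
    change f _ = 0
    exact f.map_eq_zero_of_eq _ (i := i) (j := j) (by simpa [i.2, j.2] using h)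
      (Subtype.coe_injective.ne hij)

end Alternating

/-! ### The norm of a product -/

section NormProduct

variable {R : Type*} [CommRing R] {k : ℕ} {n : Fin k → ℕ} {A : Fin k → Type*}
  [∀ i, CommRing (A i)] [∀ i, Algebra R (A i)]

/-- The arguments in the `i`-th factor of `∏ᵢ Aᵢ`, as arguments of an alternating map on `Aᵢ`. -/
theorem AlternatingMap.map_single_eq {ι : Type*} {N : Type*} [AddCommGroup N] [Module R N]
    (f : (∀ i, A i) [⋀^ι]→ₗ[R] N) (c : ι → Fin k) (i : Fin k) (v w : ι → ∀ i, A i)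
    (hvw : ∀ j, c j ≠ i → v j (c j) = w j (c j)) :
    f (fun j => Pi.single (c j) (v j (c j))) =
      ((f.domDomRestrict (fun j => c j = i) fun j => Pi.single (c j) (w j (c j))).compLinearMap
        (LinearMap.single R A i)) fun j => v j i := by
  change f _ = f _
  congr 1
  funext j
  split_ifs with h
  · subst h
    rfl
  · rw [hvw j h]

/-- The norm on a product of algebras is the product of the norms of the components. -/
theorem IsNorm.pi (hA : ∀ i, IsLocallySpanned R (A i) (n i)) {a : ∀ i, A i} {r : Fin k → R}
    (h : ∀ i, IsNorm R (n i) (a i) (r i)) : IsNorm R (∑ i, n i) a (∏ i, r i) := by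
  classical
  intro v
  have hexp : ∀ w : Fin (∑ i, n i) → ∀ i, A i, exteriorPower.ιMulti R (∑ i, n i) w =
      ∑ c : Fin (∑ i, n i) → Fin k,
        exteriorPower.ιMulti R (∑ i, n i) fun j => Pi.single (c j) (w j (c j)) := by
    intro w
    have := (exteriorPower.ιMulti R (∑ i, n i) (M := ∀ i, A i)).toMultilinearMap.map_sum
      fun j i => Pi.single i (w j i)
    simpa only [Finset.univ_sum_single, AlternatingMap.coe_multilinearMap] using this
  rw [hexp, hexp v, Finset.smul_sum]
  refine Finset.sum_congr rfl fun c _ => ?_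
  generalize exteriorPower.ιMulti R (∑ i, n i) (M := ∀ i, A i) = f
  by_cases hc : ∃ i, n i < Fintype.card {j // c j = i}
  · -- more than `nᵢ` arguments in the `i`-th factor: both sides vanish
    obtain ⟨i, hi⟩ := hc
    have hzero : ∀ w : Fin (∑ i, n i) → ∀ i, A i,
        f (fun j => Pi.single (c j) (w j (c j))) = 0 := fun w =>
      (f.map_single_eq c i w w fun _ _ => rfl).trans
        (AlternatingMap.congr_fun ((hA i).alternatingMap_eq_zero hi _) _)
    exact (hzero fun j => a * v j).trans (by rw [hzero v, smul_zero])
  · push Not at hc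
    have hcard : ∀ i, Fintype.card {j // c j = i} = n i := by
      have hsum : ∑ i, Fintype.card {j // c j = i} = ∑ i, n i := by
        rw [← Fintype.card_sigma, Fintype.card_congr (Equiv.sigmaFiberEquiv c), Fintype.card_fin]
      exact fun i => (Finset.sum_eq_sum_iff_of_le fun i _ => hc i).mp hsum i (Finset.mem_univ i)
    -- the factors of `a` are absorbed one at a time
    have hstep : ∀ (b : ∀ i, A i) (i : Fin k),
        f (fun j => Pi.single (c j) ((Function.update b i (a i * b i) * v j) (c j))) =
          r i • f fun j => Pi.single (c j) ((b * v j) (c j)) := by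
      intro b i
      rw [f.map_single_eq c i (fun j => b * v j) (fun j => b * v j) fun _ _ => rfl,
        f.map_single_eq c i (fun j => Function.update b i (a i * b i) * v j) (fun j => b * v j)
          fun j hj => by simp [Function.update_of_ne hj], ← (h i).map_mul (hcard i)]
      congr 1
      funext j
      simp [mul_assoc]
    have hall : ∀ s : Finset (Fin k),
        f (fun j => Pi.single (c j) ((s.piecewise a 1 * v j) (c j))) =
          (∏ i ∈ s, r i) • f fun j => Pi.single (c j) (v j (c j)) := by
      intro s
      induction s using Finset.induction_on with
      | empty => simp
      | insert i s hi ih =>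
        have := hstep (s.piecewise a 1) i
        rw [Finset.piecewise_eq_of_notMem _ _ _ hi, Pi.one_apply, mul_one] at this
        rw [Finset.piecewise_insert, this, ih, Finset.prod_insert hi, mul_smul]
    simpa using hall Finset.univ

theorem IsNorm.map_algEquiv {A B : Type*} [CommRing A] [Algebra R A] [CommRing B] [Algebra R B]
    (e : A ≃ₐ[R] B) {m : ℕ} {a : A} {r : R} (h : IsNorm R m (e a) r) : IsNorm R m a r := by
  intro v
  have := congrArg (exteriorPower.map m e.symm.toLinearMap) (h (e ∘ v))
  rw [map_smul, exteriorPower.map_apply_ιMulti, exteriorPower.map_apply_ιMulti] at this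
  simpa [Function.comp_def] using this

end NormProduct

/-! ### Induced maps on invariants -/

section Induced

variable {R : Type*} [CommRing R]

theorem piTensorMap_surjective {ι : Type*} [Fintype ι] [DecidableEq ι] {B C : ι → Type*}
    [∀ i, CommRing (B i)] [∀ i, Algebra R (B i)] [∀ i, CommRing (C i)] [∀ i, Algebra R (C i)]
    {f : ∀ i, B i →ₐ[R] C i} (hf : ∀ i, Function.Surjective (f i)) :
    Function.Surjective (piTensorMap f) := by
  intro t
  induction t using PiTensorProduct.induction_on with
  | smul_tprod r c =>
    choose b hb using fun i => hf i (c i)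
    exact ⟨r • PiTensorProduct.tprod R b, by rw [map_smul, piTensorMap_tprod]; simp only [hb]⟩
  | add x y hx hy =>
    obtain ⟨a, rfl⟩ := hx
    obtain ⟨b, rfl⟩ := hy
    exact ⟨a + b, map_add _ _ _⟩

theorem piTensorLift_piTensorMap {ι : Type*} [Fintype ι] [DecidableEq ι] {B C : ι → Type*}
    [∀ i, CommRing (B i)] [∀ i, Algebra R (B i)] [∀ i, CommRing (C i)] [∀ i, Algebra R (C i)]
    {S : Type*} [CommRing S] [Algebra R S] (g : ∀ i, C i →ₐ[R] S) (f : ∀ i, B i →ₐ[R] C i)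
    (u : ⨂[R] i, B i) :
    piTensorLift g (piTensorMap f u) = piTensorLift (fun i => (g i).comp (f i)) u := by
  have : (piTensorLift g).comp (piTensorMap f) = piTensorLift fun i => (g i).comp (f i) := by
    apply PiTensorProduct.algHom_ext
    intro i
    ext b
    simp only [AlgHom.comp_apply, piTensorMap, piTensorLift_single]
  exact DFunLike.congr_fun this u

theorem mapPow_eq_map {A B : Type*} [CommRing A] [Algebra R A] [CommRing B] [Algebra R B]
    (f : A →ₐ[R] B) {m : ℕ} (t : TensorPow R A m) :
    mapPow f m t = PiTensorProduct.map (fun _ => f.toLinearMap) t := by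
  have : (mapPow f m).toLinearMap = PiTensorProduct.map (fun _ => f.toLinearMap) := by
    ext a
    simp [mapPow, piTensorMap_tprod]
  exact LinearMap.congr_fun this t

/-- A linear section of `f` suffices, because invariants are functorial in linear maps. -/
theorem mapFixedPow_surjective {A B : Type*} [CommRing A] [Algebra R A] [CommRing B] [Algebra R B]
    {f : A →ₐ[R] B} {s : B →ₗ[R] A} (hs : f.toLinearMap ∘ₗ s = LinearMap.id) {m : ℕ}
    (G : Subgroup (Equiv.Perm (Fin m))) : Function.Surjective (mapFixedPow f G) := by
  intro t
  refine ⟨⟨_, map_mem_fixedPow s t.2⟩, Subtype.ext ?_⟩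
  change mapPow f m (PiTensorProduct.map (fun _ => s) t.1) = t
  rw [mapPow_eq_map, ← LinearMap.comp_apply, ← PiTensorProduct.map_comp, hs,
    PiTensorProduct.map_id, LinearMap.id_apply]

variable {k : ℕ} {n : Fin k → ℕ} {A : Fin k → Type*} [∀ i, CommRing (A i)] [∀ i, Algebra R (A i)]
  (G : ∀ i, Subgroup (Equiv.Perm (Fin (n i))))

theorem mapFixedPow_projA_surjective (i : Fin k) :
    Function.Surjective (mapFixedPow (projA A R i) (G i)) :=
  mapFixedPow_surjective (s := LinearMap.single R A i) (by ext; simp) (G i)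

theorem fixedToTensor_surjective : Function.Surjective (fixedToTensor A R G) :=
  piTensorMap_surjective (mapFixedPow_projA_surjective G)

variable (R) in
theorem fixedPowProd_single {B : Type*} [CommRing B] [Algebra R B] (i : Fin k)
    (s : fixedPow R B (G i)) :
    (fixedPowProd R B G (PiTensorProduct.singleAlgHom i s) : TensorPow R B (∑ i, n i)) =
      blockIncl R B n i s := by
  rw [fixedPowProd, piTensorLift_single]
  rfl

variable (R) in
theorem fixedPowProd_diagPow {B : Type*} [CommRing B] [Algebra R B] (b : B) :
    fixedPowProd R B G (PiTensorProduct.tprod R fun i => diagPow R (G i) b) =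
      diagPow R (prodSubgroup G) b := by
  refine Subtype.ext ((regroup_bijective R n B).injective ?_)
  rw [coe_fixedPowProd, regroup_ungroup, PiTensorProduct.map_tprod]
  exact (regroup_tprod fun _ => b).symm

end Induced

/-! ### The closure datum of a product -/

section ProdDatum

variable {R : Type*} [CommRing R] {k : ℕ} {n : Fin k → ℕ} {A : Fin k → Type*}
  [∀ i, CommRing (A i)] [∀ i, Algebra R (A i)] {G : ∀ i, Subgroup (Equiv.Perm (Fin (n i)))}
  (φ : ∀ i, fixedPow R (A i) (G i) →ₐ[R] R)
  (h : Function.Bijective (fixedPowProd R (∀ i, A i) G))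

theorem prodDatum_fixedPowProd (u : ⨂[R] i, fixedPow R (∀ i, A i) (G i)) :
    prodDatum φ h (fixedPowProd R (∀ i, A i) G u) =
      piTensorLift (fun i => (φ i).comp (mapFixedPow (projA A R i) (G i))) u := by
  have : (AlgEquiv.ofBijective (fixedPowProd R (∀ i, A i) G) h).symm
      (fixedPowProd R (∀ i, A i) G u) = u :=
    (AlgEquiv.ofBijective (fixedPowProd R (∀ i, A i) G) h).symm_apply_apply u
  exact (congrArg (fun u => piTensorLift φ (fixedToTensor A R G u)) this).trans
    (piTensorLift_piTensorMap φ _ u)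

theorem prodDatum_single (i : Fin k) (s : fixedPow R (∀ i, A i) (G i)) :
    prodDatum φ h (fixedPowProd R (∀ i, A i) G (PiTensorProduct.singleAlgHom i s)) =
      φ i (mapFixedPow (projA A R i) (G i) s) := by
  rw [prodDatum_fixedPowProd, piTensorLift_single, AlgHom.comp_apply]

theorem prodDatum_diagPow (a : ∀ i, A i) :
    prodDatum φ h (diagPow R (prodSubgroup G) a) = ∏ i, φ i (diagPow R (G i) (a i)) := by
  rw [← fixedPowProd_diagPow]
  refine (prodDatum_fixedPowProd φ h _).trans ((piTensorLift_tprod _ _).trans ?_)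
  refine Finset.prod_congr rfl fun i _ => congrArg (φ i) (Subtype.ext ?_)
  change mapPow (projA A R i) (n i) (PiTensorProduct.tprod R fun _ => a) = _
  rw [mapPow, piTensorMap_tprod]
  rfl

end ProdDatum

section ClosureDatum

variable {R : Type u} [CommRing R] {k : ℕ} {n : Fin k → ℕ} {A : Fin k → Type v}
  [∀ i, CommRing (A i)] [∀ i, Algebra R (A i)] {G : ∀ i, Subgroup (Equiv.Perm (Fin (n i)))}

/-- The homomorphism from `(A^{⊗m})^G`, for `A = ∏ᵢ Aᵢ`, to the invariants of the tensor power over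
`R'` of `∏ᵢ R' ⊗ Aᵢ`. -/
noncomputable def baseChangePiFixedPow (A : Fin k → Type v) [∀ i, CommRing (A i)]
    [∀ i, Algebra R (A i)] (R' : Type u) [CommRing R'] [Algebra R R'] {m : ℕ}
    (G : Subgroup (Equiv.Perm (Fin m))) :
    fixedPow R (∀ i, A i) G →ₐ[R] fixedPow R' (∀ i, R' ⊗[R] A i) G :=
  ((mapFixedPow (Algebra.TensorProduct.piRight R R' R' A).toAlgHom G).restrictScalars R).comp
    (baseChangeFixedPow R' G)

variable (R' : Type u) [CommRing R'] [Algebra R R']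

theorem blockIncl_baseChangePow (i : Fin k) (t : TensorPow R (∀ i, A i) (n i)) :
    blockIncl R' (∀ i, R' ⊗[R] A i) n i
        (mapPow (Algebra.TensorProduct.piRight R R' R' A).toAlgHom (n i)
          (baseChangePow R' (n i) t)) =
      mapPow (Algebra.TensorProduct.piRight R R' R' A).toAlgHom (∑ i, n i)
        (baseChangePow R' (∑ i, n i) (blockIncl R (∀ i, A i) n i t)) := by
  have : (((blockIncl R' (∀ i, R' ⊗[R] A i) n i).comp
        (mapPow (Algebra.TensorProduct.piRight R R' R' A).toAlgHom (n i))).restrictScalars R).comp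
        (baseChangePow R' (n i)) =
      ((mapPow (Algebra.TensorProduct.piRight R R' R' A).toAlgHom
        (∑ i, n i)).restrictScalars R).comp ((baseChangePow R' (∑ i, n i)).comp (blockIncl R (∀ i, A i) n i)) := by
    apply PiTensorProduct.algHom_ext
    intro j
    ext a
    simp only [AlgHom.comp_apply, AlgHom.restrictScalars_apply, baseChangePow, blockIncl, mapPow,
      piTensorMap, piTensorLift_single]
  exact DFunLike.congr_fun this t

theorem mapFixedPow_baseChangePiFixedPow {m : ℕ} {G : Subgroup (Equiv.Perm (Fin m))} (i : Fin k)
    (t : fixedPow R (∀ i, A i) G) :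
    mapFixedPow (projA (fun i => R' ⊗[R] A i) R' i) G (baseChangePiFixedPow A R' G t) =
      baseChangeFixedPow R' G (mapFixedPow (projA A R i) G t) := by
  have : ((mapPow (projA (fun i => R' ⊗[R] A i) R' i) m).restrictScalars R).comp
        (((mapPow (Algebra.TensorProduct.piRight R R' R' A).toAlgHom m).restrictScalars R).comp
          (baseChangePow R' m)) =
      (baseChangePow R' m).comp (mapPow (projA A R i) m) := by
    apply PiTensorProduct.algHom_ext
    intro j
    ext a
    simp only [AlgHom.comp_apply, AlgHom.restrictScalars_apply, baseChangePow, mapPow,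
      piTensorMap, piTensorLift_single]
    simp [-PiTensorProduct.singleAlgHom_apply]
  exact Subtype.ext (DFunLike.congr_fun this t.1)

/-- Over `R'`, the homomorphism that witnesses the Ferrand property is the one assembled from the
witnesses for the factors, with the full symmetric groups in place of the `Gᵢ`. -/
theorem isClosureDatum_prodDatum (hA : ∀ i, IsLocallyFreeOfRank R (A i) (n i))
    {φ : ∀ i, fixedPow R (A i) (G i) →ₐ[R] R} (hφ : ∀ i, IsClosureDatum (φ i))
    (h : Function.Bijective (fixedPowProd R (∀ i, A i) G)) :
    IsClosureDatum (prodDatum φ h) := by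
  intro R' _ _
  have := (IsLocallyFreeOfRank.pi hA).projective
  have := (IsLocallyFreeOfRank.pi hA).finitePresentation
  let e := Algebra.TensorProduct.piRight R R' R' A
  have := Module.Projective.of_equiv e.toLinearEquiv
  have := Module.Finite.equiv e.toLinearEquiv
  choose F' hnorm hcompat using fun i => hφ i R'
  have hbij : Function.Bijective
      (fixedPowProd R (∀ i, A i) fun i => (⊤ : Subgroup (Equiv.Perm (Fin (n i))))) :=
    fixedPowProd_bijective _ _
  have hbij' : Function.Bijective
      (fixedPowProd R' (∀ i, R' ⊗[R] A i) fun i => (⊤ : Subgroup (Equiv.Perm (Fin (n i))))) :=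
    fixedPowProd_bijective _ _
  refine ⟨(prodDatum F' hbij').comp ((fixedPowInclusion R' _ le_top).comp
    (mapFixedPow e.toAlgHom ⊤)), fun a => ?_, fun t => ?_⟩
  · refine IsNorm.map_algEquiv e ?_
    have : (fixedPowInclusion R' _ le_top).comp
        (mapFixedPow e.toAlgHom ⊤) (diagPow R' ⊤ a) =
        diagPow R' (prodSubgroup fun i => (⊤ : Subgroup (Equiv.Perm (Fin (n i)))))
          (e a) := by
      refine Subtype.ext ?_
      change mapPow _ _ (PiTensorProduct.tprod R' fun _ => a) = _
      rw [mapPow, piTensorMap_tprod]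
      rfl
    rw [AlgHom.comp_apply, this, prodDatum_diagPow]
    exact IsNorm.pi (fun i => (hA i).isLocallySpanned.baseChange R') fun i => hnorm i _
  · obtain ⟨u, hu⟩ := hbij.surjective (fixedPowInclusion R _ le_top t)
    -- `u` is invariant under the full symmetric group of each block; it is compared with its
    -- image among the tensors of `Gᵢ`-invariants and with its base change
    let incl : (⨂[R] i, fixedPow R (∀ i, A i) (⊤ : Subgroup (Equiv.Perm (Fin (n i))))) →ₐ[R]
        ⨂[R] i, fixedPow R (∀ i, A i) (G i) :=
      piTensorMap fun i => fixedPowInclusion R _ le_top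
    let base : (⨂[R] i, fixedPow R (∀ i, A i) (⊤ : Subgroup (Equiv.Perm (Fin (n i))))) →ₐ[R]
        ⨂[R'] i, fixedPow R' (∀ i, R' ⊗[R] A i) (⊤ : Subgroup (Equiv.Perm (Fin (n i)))) :=
      piTensorLift (S := ⨂[R'] i, fixedPow R' (∀ i, R' ⊗[R] A i)
        (⊤ : Subgroup (Equiv.Perm (Fin (n i))))) fun i =>
          ((PiTensorProduct.singleAlgHom i).restrictScalars R).comp (baseChangePiFixedPow A R' ⊤)
    have h1 : fixedPowProd R (∀ i, A i) G (incl u) = fixedPowInclusion R _ le_top t := by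
      have : (fixedPow R (∀ i, A i) (prodSubgroup G)).val.comp
            ((fixedPowProd R (∀ i, A i) G).comp incl) =
          (fixedPow R (∀ i, A i) (prodSubgroup fun i => ⊤)).val.comp
            (fixedPowProd R (∀ i, A i) fun i => ⊤) := by
        apply PiTensorProduct.algHom_ext
        intro i
        ext s
        simp only [AlgHom.comp_apply, incl, piTensorMap, piTensorLift_single, Subalgebra.coe_val,
          fixedPowProd_single]
        rfl
      exact Subtype.ext ((DFunLike.congr_fun this u).trans (congrArg Subtype.val hu))
    have h2 : fixedPowProd R' (∀ i, R' ⊗[R] A i) (fun i => ⊤) (base u) =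
        (fixedPowInclusion R' _ le_top).comp
          (mapFixedPow e.toAlgHom ⊤)
            (baseChangeFixedPow R' ⊤ t) := by
      have : (((fixedPow R' (∀ i, R' ⊗[R] A i)
            (prodSubgroup fun i => (⊤ : Subgroup (Equiv.Perm (Fin (n i)))))).val.comp
            (fixedPowProd R' (∀ i, R' ⊗[R] A i) fun i => ⊤)).restrictScalars R).comp base =
          (((mapPow e.toAlgHom _).restrictScalars R).comp
            (baseChangePow R' _)).comp ((fixedPow R (∀ i, A i) (prodSubgroup fun i => ⊤)).val.comp
              (fixedPowProd R (∀ i, A i) fun i => ⊤)) := by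
        apply PiTensorProduct.algHom_ext
        intro i
        ext s
        simp only [AlgHom.comp_apply, AlgHom.restrictScalars_apply, base, piTensorLift_single,
          Subalgebra.coe_val, fixedPowProd_single]
        exact blockIncl_baseChangePow R' i s.1
      exact Subtype.ext ((DFunLike.congr_fun this u).trans (congrArg
        (fun x => mapPow e.toAlgHom _ (baseChangePow R' _ x)) (congrArg Subtype.val hu)))
    have h3 : (((prodDatum F' hbij').comp (fixedPowProd R' _ fun i => ⊤)).restrictScalars R).comp
          base = (Algebra.ofId R R').comp
            ((prodDatum φ h).comp ((fixedPowProd R _ G).comp incl)) := by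
      apply PiTensorProduct.algHom_ext
      intro i
      ext s
      simp only [AlgHom.comp_apply, AlgHom.restrictScalars_apply, base, incl, piTensorMap,
        piTensorLift_single, prodDatum_single]
      rw [mapFixedPow_baseChangePiFixedPow, hcompat]
      rfl
    rw [AlgHom.comp_apply, ← h2, AlgHom.comp_apply, ← h1]
    exact DFunLike.congr_fun h3 u

end ClosureDatum

/-! ### Homomorphisms out of a closure algebra -/

section ClosureLift

variable {R : Type*} {A : Type*} [CommRing R] [CommRing A] [Algebra R A] {n : ℕ}
  {G : Subgroup (Equiv.Perm (Fin n))} (φ : fixedPow R A G →ₐ[R] R)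

/-- For an invariant tensor `t`, the elements `t ⊗ 1` and `1 ⊗ φ(t)` agree. -/
theorem toClosure_coe (t : fixedPow R A G) :
    toClosure φ t = algebraMap R (ClosureAlgebra φ) (φ t) := by
  have key : ∀ s : fixedPow R A G, toClosure φ s =
      (1 : TensorPow R A n) ⊗ₜ[fixedPow R A G] algebraMap (fixedPow R A G) (ScalarsVia φ) s :=
    fun s => by
      change (s : TensorPow R A n) ⊗ₜ[fixedPow R A G] (1 : ScalarsVia φ) = _
      rw [Algebra.algebraMap_eq_smul_one, ← TensorProduct.smul_tmul, Algebra.smul_def, mul_one]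
      rfl
  have h := key (algebraMap R _ (φ t))
  have hφ : algebraMap (fixedPow R A G) (ScalarsVia φ) (algebraMap R _ (φ t)) =
      algebraMap (fixedPow R A G) (ScalarsVia φ) t := φ.commutes (φ t)
  rw [hφ, ← key] at h
  rw [← h]
  exact (toClosure φ).commutes (φ t)

theorem toClosure_surjective : Function.Surjective (toClosure φ) := by
  intro x
  induction x using TensorProduct.induction_on with
  | zero => exact ⟨0, map_zero _⟩
  | tmul t r =>
    refine ⟨algebraMap R (TensorPow R A n) (r : R) * t, ?_⟩
    have hr : algebraMap (fixedPow R A G) (ScalarsVia φ) (algebraMap R _ (r : R)) = r :=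
      φ.commutes r
    change (algebraMap R (TensorPow R A n) (r : R) * t) ⊗ₜ[fixedPow R A G] (1 : ScalarsVia φ) = _
    conv_rhs => rw [← hr, Algebra.algebraMap_eq_smul_one, ← TensorProduct.smul_tmul]
    rfl
  | add x y hx hy =>
    obtain ⟨a, rfl⟩ := hx
    obtain ⟨b, rfl⟩ := hy
    exact ⟨a + b, map_add _ _ _⟩

variable {φ} in
/-- A homomorphism from `A^{⊗n}` that agrees with `φ` on the invariants factors through the closure
algebra. -/
theorem exists_comp_toClosure_eq {C : Type*} [CommRing C] [Algebra R C]
    (f : TensorPow R A n →ₐ[R] C) (hf : ∀ t : fixedPow R A G, f t = algebraMap R C (φ t)) :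
    ∃ F : ClosureAlgebra φ →ₐ[R] C, F.comp (toClosure φ) = f := by
  let _ : Algebra (fixedPow R A G) C := (f.comp (fixedPow R A G).val).toRingHom.toAlgebra
  have : IsScalarTower R (fixedPow R A G) C :=
    .of_algebraMap_eq fun r => ((f.comp (fixedPow R A G).val).commutes r).symm
  let f' : TensorPow R A n →ₐ[fixedPow R A G] C := { f with commutes' := fun _ => rfl }
  let g : ScalarsVia φ →ₐ[fixedPow R A G] C :=
    { algebraMap R C with commutes' := fun t => (hf t).symm }
  refine ⟨(Algebra.TensorProduct.productMap f' g).restrictScalars R, AlgHom.ext fun t => ?_⟩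
  exact Algebra.TensorProduct.productMap_left_apply f' g t

/-- The homomorphism `π` presents `C` as the closure algebra of `φ`, that is, as the quotient of
`A^{⊗n}` by the ideal generated by the differences `t - φ(t)`, for invariant `t`. -/
structure IsClosureMap {C : Type*} [CommRing C] [Algebra R C] (π : TensorPow R A n →ₐ[R] C) :
    Prop where
  surjective : Function.Surjective π
  map_coe : ∀ t : fixedPow R A G, π t = algebraMap R C (φ t)
  mem_span : ∀ t, π t = 0 → t ∈ Ideal.span (Set.range fun s : fixedPow R A G =>
    (s : TensorPow R A n) - algebraMap R (TensorPow R A n) (φ s))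

theorem isClosureMap_toClosure : IsClosureMap φ (toClosure φ) := by
  refine ⟨toClosure_surjective φ, toClosure_coe φ, fun t ht => ?_⟩
  obtain ⟨F, hF⟩ := exists_comp_toClosure_eq (φ := φ) (Ideal.Quotient.mkₐ R (Ideal.span
    (Set.range fun s : fixedPow R A G =>
      (s : TensorPow R A n) - algebraMap R (TensorPow R A n) (φ s)))) fun s =>
    (Ideal.Quotient.mk_eq_mk_iff_sub_mem _ _).mpr (Ideal.subset_span ⟨s, rfl⟩)
  have := DFunLike.congr_fun hF t
  rw [AlgHom.comp_apply, ht, map_zero] at this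
  exact Ideal.Quotient.eq_zero_iff_mem.mp this.symm

theorem IsClosureMap.exists_comp_eq {φ : fixedPow R A G →ₐ[R] R} {C D : Type*} [CommRing C]
    [Algebra R C] [CommRing D] [Algebra R D] {π : TensorPow R A n →ₐ[R] C} (hπ : IsClosureMap φ π)
    (f : TensorPow R A n →ₐ[R] D) (hf : ∀ t : fixedPow R A G, f t = algebraMap R D (φ t)) :
    ∃ F : C →ₐ[R] D, ∀ t, F (π t) = f t := by
  have hker : RingHom.ker π ≤ RingHom.ker f := fun t ht => by
    refine Ideal.span_le.mpr ?_ (hπ.mem_span t ht)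
    rintro _ ⟨s, rfl⟩
    rw [SetLike.mem_coe, RingHom.mem_ker, map_sub, hf, AlgHom.commutes, sub_self]
  exact ⟨AlgHom.liftOfSurjective π hπ.surjective f hker,
    AlgHom.liftOfSurjective_apply π hπ.surjective f hker⟩

end ClosureLift

/-! ### The closure algebra of a product -/

section ClosureProduct

variable {R : Type*} [CommRing R] {k : ℕ} {n : Fin k → ℕ} {A : Fin k → Type*}
  [∀ i, CommRing (A i)] [∀ i, Algebra R (A i)] {G : ∀ i, Subgroup (Equiv.Perm (Fin (n i)))}
  (φ : ∀ i, fixedPow R (A i) (G i) →ₐ[R] R)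
  (h : Function.Bijective (fixedPowProd R (∀ i, A i) G))

theorem powToTensor_conjFactor (i : Fin k) (j : Fin (n i)) (a : ∀ i, A i) :
    powToTensor A R n (conjFactor R (finSigmaFinEquiv ⟨i, j⟩) a) =
      PiTensorProduct.singleAlgHom i (conjFactor R j (a i)) := by
  simp only [powToTensor, regroup, AlgHom.comp_apply, piTensorLift_single]
  rw [Equiv.symm_apply_apply]
  simp only [piTensorMap, mapPow, AlgHom.comp_apply, piTensorLift_single]
  rfl

theorem powToTensor_blockIncl (i : Fin k) (t : TensorPow R (∀ i, A i) (n i)) :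
    powToTensor A R n (blockIncl R _ n i t) =
      PiTensorProduct.singleAlgHom i (mapPow (projA A R i) (n i) t) := by
  have : (powToTensor A R n).comp (blockIncl R _ n i) =
      (PiTensorProduct.singleAlgHom i).comp (mapPow (projA A R i) (n i)) := by
    apply PiTensorProduct.algHom_ext
    intro j
    ext a
    simp only [AlgHom.comp_apply, blockIncl, piTensorLift_single, powToTensor_conjFactor, mapPow,
      piTensorMap]
    rfl
  exact DFunLike.congr_fun this t

variable {φ h} {C : Type*} [CommRing C] [Algebra R C]
  {π : TensorPow R (∀ i, A i) (∑ i, n i) →ₐ[R] C} (hπ : IsClosureMap (prodDatum φ h) π)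
  {D : Fin k → Type*} [∀ i, CommRing (D i)] [∀ i, Algebra R (D i)]
  {ϖ : ∀ i, TensorPow R (A i) (n i) →ₐ[R] D i} (hϖ : ∀ i, IsClosureMap (φ i) (ϖ i))

include hϖ in
theorem piTensorMap_powToTensor (t : fixedPow R (∀ i, A i) (prodSubgroup G)) :
    piTensorMap ϖ (powToTensor A R n t) = algebraMap R _ (prodDatum φ h t) := by
  obtain ⟨u, rfl⟩ := h.surjective t
  have : ((piTensorMap ϖ).comp (powToTensor A R n)).comp
      ((fixedPow R (∀ i, A i) (prodSubgroup G)).val.comp (fixedPowProd R _ G)) =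
      (Algebra.ofId R _).comp ((prodDatum φ h).comp (fixedPowProd R _ G)) := by
    apply PiTensorProduct.algHom_ext
    intro i
    ext s
    simp only [AlgHom.comp_apply, Subalgebra.coe_val, fixedPowProd_single, powToTensor_blockIncl,
      prodDatum_single, piTensorMap, piTensorLift_single]
    exact (congrArg _ ((hϖ i).map_coe (mapFixedPow (projA A R i) (G i) s))).trans
      (AlgHom.commutes _ _)
  exact DFunLike.congr_fun this u

include hπ

theorem IsClosureMap.map_blockIncl (i : Fin k) (s : fixedPow R (∀ i, A i) (G i)) :
    π (blockIncl R _ n i s) = algebraMap R C (φ i (mapFixedPow (projA A R i) (G i) s)) := by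
  rw [← fixedPowProd_single, hπ.map_coe, prodDatum_single]

/-- The idempotent of `A = ∏ᵢ Aᵢ` that projects to the `i`-th factor becomes `1` in the closure
algebra when placed in the `i`-th block: it divides the invariant tensor whose factors in that
block are all equal to this idempotent, and `φ` sends that tensor to `1`. -/
theorem IsClosureMap.map_single_one (i : Fin k) (j : Fin (n i)) :
    π (conjFactor R (finSigmaFinEquiv ⟨i, j⟩) (Pi.single i 1)) = 1 := by
  let e : ∀ i, A i := Pi.single i 1
  have hee : e * e = e := by simp [e, ← Pi.single_mul]
  have hone : π (blockIncl R _ n i (diagPow R (G i) e)) = 1 := by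
    have : mapFixedPow (projA A R i) (G i) (diagPow R (G i) e) = 1 := by
      refine Subtype.ext ?_
      change mapPow (projA A R i) (n i) (PiTensorProduct.tprod R fun _ => e) = 1
      rw [mapPow, piTensorMap_tprod, PiTensorProduct.one_def]
      congr 1
      funext _
      simp [e]
    rw [hπ.map_blockIncl, this, map_one, map_one]
  have hmul : conjFactor R j e * (diagPow R (G i) e : TensorPow R (∀ i, A i) (n i)) =
      diagPow R (G i) e := by
    change PiTensorProduct.singleAlgHom j e * PiTensorProduct.tprod R (fun _ => e) =
      PiTensorProduct.tprod R fun _ => e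
    rw [PiTensorProduct.singleAlgHom_apply]
    change PiTensorProduct.tprod R (Pi.mulSingle j e) * PiTensorProduct.tprod R (fun _ => e) = _
    rw [PiTensorProduct.tprod_mul_tprod]
    congr 1
    funext j'
    rcases eq_or_ne j' j with rfl | hj
    · simp [hee]
    · simp [Pi.mulSingle_eq_of_ne hj]
  have := congrArg (fun t => π (blockIncl R _ n i t)) hmul
  simp only [map_mul, hone, mul_one] at this
  rw [← this, blockIncl, piTensorLift_single]

/-- The homomorphism from `Aᵢ` to the closure algebra of the product that places an element in the
`j`-th factor of the `i`-th block. -/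
noncomputable def IsClosureMap.factor (i : Fin k) (j : Fin (n i)) :
    A i →ₐ[R] C :=
  AlgHom.ofLinearMap
    ((π.comp (conjFactor R (finSigmaFinEquiv ⟨i, j⟩))).toLinearMap ∘ₗ
      LinearMap.single R A i)
    (hπ.map_single_one i j)
    fun x y => by
      change (π.comp (conjFactor R (finSigmaFinEquiv ⟨i, j⟩)))
        (Pi.single i (x * y)) = _
      rw [Pi.single_mul, map_mul]
      rfl

theorem IsClosureMap.factor_apply (i : Fin k) (j : Fin (n i)) (a : ∀ i, A i) :
    hπ.factor i j (a i) =
      π (conjFactor R (finSigmaFinEquiv ⟨i, j⟩) a) := by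
  have : (Pi.single i (a i) : ∀ i, A i) = a * Pi.single i 1 := by
    funext i'
    rcases eq_or_ne i' i with rfl | hi
    · simp
    · simp [Pi.single_eq_of_ne hi]
  change π (conjFactor R _ (Pi.single i (a i))) = _
  rw [this, map_mul, map_mul, hπ.map_single_one, mul_one]

theorem IsClosureMap.piTensorLift_factor (i : Fin k) (t : TensorPow R (∀ i, A i) (n i)) :
    piTensorLift (hπ.factor i) (mapPow (projA A R i) (n i) t) =
      π (blockIncl R _ n i t) := by
  have : (piTensorLift (hπ.factor i)).comp (mapPow (projA A R i) (n i)) =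
      π.comp (blockIncl R _ n i) := by
    apply PiTensorProduct.algHom_ext
    intro j
    ext a
    simp only [AlgHom.comp_apply, mapPow, piTensorMap, blockIncl, piTensorLift_single]
    exact hπ.factor_apply i j a
  exact DFunLike.congr_fun this t

omit hπ in
/-- A closure algebra of the product is the tensor product of closure algebras of the factors. -/
theorem IsClosureMap.exists_algEquiv (hπ : IsClosureMap (prodDatum φ h) π)
    (hϖ : ∀ i, IsClosureMap (φ i) (ϖ i)) :
    ∃ e : C ≃ₐ[R] ⨂[R] i, D i, ∀ t, e (π t) = piTensorMap ϖ (powToTensor A R n t) := by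
  obtain ⟨F, hF⟩ := hπ.exists_comp_eq ((piTensorMap ϖ).comp (powToTensor A R n))
    (piTensorMap_powToTensor hϖ)
  have hblock : ∀ i, ∃ g : D i →ₐ[R] C, ∀ t, g (ϖ i t) = piTensorLift (hπ.factor i) t := by
    intro i
    refine (hϖ i).exists_comp_eq _ fun t => ?_
    obtain ⟨s, rfl⟩ := mapFixedPow_projA_surjective G i t
    rw [← hπ.map_blockIncl]
    exact hπ.piTensorLift_factor i s
  choose g hg using hblock
  refine ⟨AlgEquiv.ofAlgHom F (piTensorLift g) ?_ ?_, hF⟩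
  · apply PiTensorProduct.algHom_ext
    intro i
    refine (AlgHom.cancel_right (hϖ i).surjective).mp ?_
    apply PiTensorProduct.algHom_ext
    intro j
    ext a
    obtain ⟨b, rfl⟩ := Function.surjective_eval i a
    simp only [AlgHom.comp_apply, piTensorLift_single, AlgHom.id_apply, hg, Function.eval]
    rw [hπ.factor_apply, hF, AlgHom.comp_apply, powToTensor_conjFactor, piTensorMap,
      piTensorLift_single]
    rfl
  · refine (AlgHom.cancel_right hπ.surjective).mp ?_
    apply PiTensorProduct.algHom_ext
    intro p
    obtain ⟨⟨i, j⟩, rfl⟩ := finSigmaFinEquiv.surjective p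
    ext a
    simp only [AlgHom.comp_apply, AlgHom.id_apply, hF]
    rw [powToTensor_conjFactor, piTensorMap, piTensorLift_single, AlgHom.comp_apply,
      piTensorLift_single, hg, piTensorLift_single, hπ.factor_apply]

end ClosureProduct

/-! ### Products of closure data -/

theorem mainTheorem5 {R : Type u} [CommRing R] {k : ℕ} (n : Fin k → ℕ)
    (A : Fin k → Type v) [∀ i, CommRing (A i)] [∀ i, Algebra R (A i)]
    (hA : ∀ i, IsLocallyFreeOfRank R (A i) (n i))
    (G : ∀ i, Subgroup (Equiv.Perm (Fin (n i))))
    (φ : ∀ i, fixedPow R (A i) (G i) →ₐ[R] R)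
    (hφ : ∀ i, IsClosureDatum (φ i)) :
    IsLocallyFreeOfRank R (∀ i, A i) (∑ i, n i) ∧
    Function.Bijective (regroup R (∀ i, A i) n) ∧
    Function.Surjective (fixedToTensor A R G) ∧
    ∃ h : Function.Bijective (fixedPowProd R (∀ i, A i) G),
      IsClosureDatum (prodDatum φ h) ∧
      ∃ e : ClosureAlgebra (prodDatum φ h) ≃ₐ[R] ⨂[R] i, ClosureAlgebra (φ i),
        ∀ t, e (toClosure (prodDatum φ h) t) =
          piTensorMap (fun i => toClosure (φ i)) (powToTensor A R n t) := by
  have hfree := IsLocallyFreeOfRank.pi hA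
  have := hfree.finitePresentation
  have := hfree.projective
  have h : Function.Bijective (fixedPowProd R (∀ i, A i) G) := fixedPowProd_bijective _ G
  exact ⟨hfree, regroup_bijective R n _, fixedToTensor_surjective G, h,
    isClosureDatum_prodDatum hA hφ h,
    (isClosureMap_toClosure _).exists_algEquiv fun i => isClosureMap_toClosure (φ i)⟩
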